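/- Let $\mathcal P\subset\mathbb R^2$ be a finite set of points and $n\ge 1$. For a point $u$ and $0\le j<n$ let $C_u^j$ be the cone with apex $u$ consisting of the rays with polar angle in $[2j\pi/n,2(j+1)\pi/n)$ (apex excluded). *Yao-Yao graph.* A Yao graph $\mathsf Y_n$ of $\mathcal P$ is a directed graph obtained by selecting, for every $u\in\mathcal P$ and every $j$ with $C_u^j\cap\mathcal P\ne\emptyset$, one point $v\in C_u^j\cap\mathcal P$ nearest to $u$ and adding the edge $\overrightarrow{uv}$. A Yao-Yao graph $\mathsf{YY}_n$ is obtained from it by keeping, for every $u\in\mathcal P$ and every $j$ for which some $v\in C_u^j\cap\mathcal P$ has $\overrightarrow{vu}\in\mathsf Y_n$, one shortest such edge $\overrightarrow{vu}$. Ties are broken arbitrarily in both steps. *Trapezoidal Yao graph.* Let $\theta=\lceil n/8\rceil\cdot 2\pi/n$, let $T=\{(x,y): 0<x<1,\ 0<y<\sin\theta,\ x^2+y^2<1,\ (x-1)^2+y^2<1\}$, and let $T^-$ be the reflection of $T$ through the $x$-axis. The critical arc of $T$ consists of the points of the unit circle with polar angle in $[0,\theta)$, that of $T^-$ of those with polar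 angle in $[-\theta,0]$. For every $u\in\mathcal P$, $0\le j<n$ and $\Gamma\in\{T,T^-\}$, rotate $\Gamma$ by $2j\pi/n$ about the origin, attach the origin to $u$, and scale by a factor $\lambda$ that grows from $0$ until the boundary first hits a point of $\mathcal P\setminus\{u\}$; for every point $v\in\mathcal P$ that is then hit by the critical arc, $\overrightarrow{uv}$ is an edge of $\mathsf{TY}_n$. For a graph $G$ on $\mathcal P$ let $d_G(u,v)$ be the Euclidean length of a shortest $u$–$v$ path in $G$, edge directions being ignored ($\infty$ if there is none). **Lemma.** There are constants $\tau'_k$, depending only on $k$, with $\tau'_k=\sqrt2+O(1/k)$ as $k\to\infty$, such that for every integer $k\ge 42$, every finite $\mathcal P\subset\mathbb R^2$ and every Yao-Yao graph $\mathsf{YY}_{2k}$ of $\mathcal P$, $$d_{\mathsf{YY}_{2k}}(u,v)\le\tau'_k\,|uv|\qquad\text{for every edge }\overrightarrow{uv}\text{ of }\mathsf{TY}_{2k}.$$ Consequently $\mathsf{YY}_{2k}$ spans $\mathsf{TY}_{2k}$: $d_{\mathsf{YY}_{2k}}(u,v)\le\tau'_k\,d_{\mathsf{TY}_{2k}}(u,v)$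 for all $u,v\in\mathcal P$. -/

import Mathlib

open scoped ENNReal

noncomputable section

namespace YaoYao

/-- The cone with apex `u` made of the rays with polar angle in `[γ₁, γ₂)` (angles modulo `2π`; the
apex is not included). The Euclidean plane is identified with `ℂ`. -/
def cone (u : ℂ) (γ₁ γ₂ : ℝ) : Set ℂ :=
  {v | ∃ r φ : ℝ, 0 < r ∧ γ₁ ≤ φ ∧ φ < γ₂ ∧ v = u + (r : ℂ) * Complex.exp ((φ : ℂ) * Complex.I)}

/-- The `j`-th of the `n` cones with apex `u`. -/
def yaoCone (n j : ℕ) (u : ℂ) : Set ℂ :=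
  cone u (2 * j * Real.pi / n) (2 * ((j : ℝ) + 1) * Real.pi / n)

/-- `sel` is a possible outcome of a selection step with `n` cones on `P`: for every `u ∈ P` and every
cone with apex `u` that contains a candidate (a point `v ∈ P` with `cand u v`), exactly one candidate
of the cone is selected, and it is a nearest one. Ties may be broken in any way. -/
structure IsYaoStep (n : ℕ) (P : Finset ℂ) (cand sel : ℂ → ℂ → Prop) : Prop where
  nearest : ∀ u v, sel u v → u ∈ P ∧ v ∈ P ∧ cand u v ∧
    ∃ j < n, v ∈ yaoCone n j u ∧
      ∀ w ∈ P, w ∈ yaoCone n j u → cand u w → dist u v ≤ dist u w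
  existsUnique : ∀ u ∈ P, ∀ j < n, (∃ v ∈ P, v ∈ yaoCone n j u ∧ cand u v) →
    ∃! v, v ∈ yaoCone n j u ∧ sel u v

/-- `Y` is a (directed) Yao graph of `P` with `n` cones. -/
def IsYaoGraph (n : ℕ) (P : Finset ℂ) (Y : ℂ → ℂ → Prop) : Prop :=
  IsYaoStep n P (fun _ _ => True) Y

/-- `E` is a (directed) Yao-Yao graph obtained from the Yao graph `Y` by the reverse Yao step: in each
cone of each `u`, one shortest edge of `Y` among those that enter `u` from that cone is kept. -/
def IsYaoYaoGraph (n : ℕ) (P : Finset ℂ) (Y E : ℂ → ℂ → Prop) : Prop :=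
  IsYaoStep n P (fun u v => Y v u) (fun u v => E v u)

/-- The (open) curved trapezoid, with bottom side from `o = 0` to `p = 1`. -/
def trapezoid (θ : ℝ) : Set ℂ :=
  {z | 0 < z.re ∧ z.re < 1 ∧ 0 < z.im ∧ z.im < Real.sin θ ∧ ‖z‖ < 1 ∧ ‖z - 1‖ < 1}

/-- The points of the unit circle with polar angle in `S`. -/
def unitArc (S : Set ℝ) : Set ℂ :=
  (fun φ : ℝ => Complex.exp ((φ : ℂ) * Complex.I)) '' S

/-- Reflection through the `x`-axis. -/
def reflect (S : Set ℂ) : Set ℂ := (starRingEnd ℂ) '' S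

/-- The copy `u + lam • (S rotated counterclockwise by γ)`. -/
def place (u : ℂ) (lam γ : ℝ) (S : Set ℂ) : Set ℂ :=
  (fun z => u + (lam : ℂ) * (Complex.exp ((γ : ℂ) * Complex.I) * z)) '' S

/-- The shape `Γ`, rotated by `γ`, attached to `u` and grown from size `0`, meets no point of `P`
other than `u` before size `lam`, and at size `lam` the part `A` of its boundary hits `v`. -/
def GrowthHits (P : Finset ℂ) (u : ℂ) (γ : ℝ) (Γ A : Set ℂ) (v : ℂ) : Prop :=
  ∃ lam : ℝ, 0 < lam ∧ v ∈ place u lam γ A ∧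
    ∀ μ : ℝ, 0 < μ → μ < lam → ∀ w ∈ P, w ∈ closure (place u μ γ Γ) → w = u

/-- The angle `θ = ⌈n/8⌉ · 2π/n`. -/
def tyAngle (n : ℕ) : ℝ := (⌈(n : ℝ) / 8⌉₊ : ℝ) * (2 * Real.pi / n)

/-- Directed edges of the trapezoidal Yao graph with parameter `n`. The critical arc of the trapezoid
is the arc of polar angles `0` to `θ`, that of the reflected trapezoid the arc of polar angles `-θ` to
`0`. As cones are half-open, the endpoint of polar angle `θ`, which belongs to the cone next to
the sector spanned by the arc, is not counted. If several points are hit at once, all those on the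
critical arc are selected. -/
def TYEdge (n : ℕ) (P : Finset ℂ) (u v : ℂ) : Prop :=
  u ∈ P ∧ v ∈ P ∧ ∃ j < n,
    GrowthHits P u (2 * j * Real.pi / n) (trapezoid (tyAngle n))
      (unitArc (Set.Ico 0 (tyAngle n))) v ∨
    GrowthHits P u (2 * j * Real.pi / n) (reflect (trapezoid (tyAngle n)))
      (unitArc (Set.Icc (-tyAngle n) 0)) v

/-- Total Euclidean length of a walk. -/
def walkLength {G : SimpleGraph ℂ} : {u v : ℂ} → G.Walk u v → ℝ
  | _, _, SimpleGraph.Walk.nil => 0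
  | _, _, @SimpleGraph.Walk.cons _ _ u w _ _ p => dist u w + walkLength p

/-- Length of a shortest `u`-`v` path in `G` (`⊤` if there is none). -/
def graphDist (G : SimpleGraph ℂ) (u v : ℂ) : ℝ≥0∞ :=
  ⨅ p : G.Walk u v, ENNReal.ofReal (walkLength p)

end YaoYao

end

open scoped ENNReal

noncomputable section

namespace YaoYao

/-! The argument yields stretch `1 + O(1/k)`; `√2` enters only through `1 ≤ √2` at the very end. Let
`α = π/k` be the aperture of a cone and `A = 1 + O(α)`.

The statement proved by induction on `|uv|` is `EdgeOK`: if the critical arc of an empty trapezoid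
attached to `u` meets `v` at polar angle `φ`, then `u` and `v` are joined by a path of length at
most `A|uv| + 3A|uv| min(sin φ, sin α)`. The surcharge is at most proportional to the height of `v`
above the bottom side. Along a path that only climbs, the surcharges therefore add up to a multiple
of the total rise, not of the length.

Induction step (`conn_of_edge`): the Yao edge of `u` in the cone of `v` ends at some `v'`, and
emptiness of the trapezoid forces `|uv'| = |uv|`. The reverse step leaves an edge `wv'` with `|wv'|
≤ |uv'|`, parallel to the same cone. The tied points `v`, `v'` are joined at cost `O(α)|uv|` by
`conn_of_arc`; the surcharge is mainly there to pay for this. It remains to connect `w` to `u`.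

If `w` lies below the bottom line, `conn_of_below` walks back to `u` through trapezoids pointing
towards `u`. The empty trapezoid at `u` keeps this walk below the line, so its total rise is at most
the depth of `w`, and it costs `A` times the abscissa plus `13.03 A` times the depth. Otherwise `w`
is to the left of the trapezoid, hence within `O(α)|uv|` of `u` (`norm_le_of_left`), and the crude
stretch `8.5 A` of `conn_of_dist_lt` is enough. In both cases the edge `wv'` is traversed with
factor `1` instead of `A`, and this saving absorbs the losses of order `α`: that is the condition `1
≤ A(1 - 13.2α)`. -/

/-! ### Walks of bounded length -/

/-- `G` has a walk from `p` to `q` of Euclidean length at most `l`. -/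
def Conn (G : SimpleGraph ℂ) (p q : ℂ) (l : ℝ) : Prop :=
  ∃ W : G.Walk p q, walkLength W ≤ l

theorem walkLength_append {G : SimpleGraph ℂ} {p q r : ℂ} (W : G.Walk p q) (W' : G.Walk q r) :
    walkLength (W.append W') = walkLength W + walkLength W' := by
  induction W with
  | nil => simp [walkLength]
  | cons h W ih => simp [walkLength, ih, add_assoc]

theorem walkLength_reverse {G : SimpleGraph ℂ} {p q : ℂ} (W : G.Walk p q) :
    walkLength W.reverse = walkLength W := by
  induction W with
  | nil => simp [walkLength]
  | cons h W ih =>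
    simp [SimpleGraph.Walk.reverse_cons, walkLength_append, walkLength, ih, dist_comm, add_comm]

namespace Conn

variable {G : SimpleGraph ℂ} {p q r : ℂ} {l l' : ℝ}

theorem refl (p : ℂ) (h : 0 ≤ l) : Conn G p p l := ⟨.nil, by simpa [walkLength] using h⟩

theorem symm (h : Conn G p q l) : Conn G q p l := by
  obtain ⟨W, hW⟩ := h
  exact ⟨W.reverse, by rwa [walkLength_reverse]⟩

theorem mono (h : Conn G p q l) (hl : l ≤ l') : Conn G p q l' := by
  obtain ⟨W, hW⟩ := h
  exact ⟨W, hW.trans hl⟩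

theorem trans (h : Conn G p q l) (h' : Conn G q r l') : Conn G p r (l + l') := by
  obtain ⟨W, hW⟩ := h
  obtain ⟨W', hW'⟩ := h'
  exact ⟨W.append W', by rw [walkLength_append]; exact add_le_add hW hW'⟩

theorem of_adj (h : G.Adj p q) : Conn G p q (dist p q) :=
  ⟨.cons h .nil, by simp [walkLength]⟩

theorem graphDist_le (h : Conn G p q l) : graphDist G p q ≤ ENNReal.ofReal l := by
  obtain ⟨W, hW⟩ := h
  exact (iInf_le _ W).trans (ENNReal.ofReal_le_ofReal hW)

end Conn

/-- If every edge of `H` is spanned by `G` with stretch `t`, then so is every walk of `H`. -/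
theorem graphDist_le_mul {G H : SimpleGraph ℂ} {t : ℝ} (ht : 0 < t)
    (h : ∀ p q, H.Adj p q → Conn G p q (t * dist p q)) (p q : ℂ) :
    graphDist G p q ≤ ENNReal.ofReal t * graphDist H p q := by
  have key : ∀ {p q : ℂ} (W : H.Walk p q), Conn G p q (t * walkLength W) := by
    intro p q W
    induction W with
    | nil => exact Conn.refl _ (by simp [walkLength])
    | cons hadj W ih =>
      refine ((h _ _ hadj).trans ih).mono ?_
      simp [walkLength, mul_add]
  unfold graphDist
  rw [ENNReal.mul_iInf_of_ne]
  · refine le_iInf fun W => ?_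
    rw [← ENNReal.ofReal_mul ht.le]
    exact (key W).graphDist_le
  · simpa using ht
  · exact ENNReal.ofReal_ne_top

/-- Strong induction on the distance between two points of a finite set. -/
theorem dist_induction (P : Finset ℂ) (Q : ℂ → ℂ → Prop)
    (h : ∀ p ∈ P, ∀ q ∈ P, (∀ p' ∈ P, ∀ q' ∈ P, dist p' q' < dist p q → Q p' q') → Q p q) :
    ∀ p ∈ P, ∀ q ∈ P, Q p q := by
  have key : ∀ N : ℕ, ∀ p ∈ P, ∀ q ∈ P,
      ((P ×ˢ P).filter fun x => dist x.1 x.2 < dist p q).card = N → Q p q := by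
    intro N
    induction N using Nat.strong_induction_on with
    | _ N ih =>
      intro p hp q hq hN
      refine h p hp q hq fun p' hp' q' hq' hlt => ih _ ?_ p' hp' q' hq' rfl
      rw [← hN]
      refine Finset.card_lt_card (Finset.ssubset_iff_of_subset ?_ |>.2 ⟨(p', q'), ?_, ?_⟩)
      · intro x hx
        simp only [Finset.mem_filter] at hx ⊢
        exact ⟨hx.1, hx.2.trans hlt⟩
      · simp [hp', hq', hlt]
      · simp
  exact fun p hp q hq => key _ p hp q hq rfl

/-! ### What the two Yao steps provide -/

/-- The point at distance `r` from `u` in the direction of polar angle `φ`. -/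
def polarPt (u : ℂ) (r φ : ℝ) : ℂ := u + (r : ℂ) * Complex.exp ((φ : ℂ) * Complex.I)

theorem dist_polarPt (u : ℂ) {r : ℝ} (hr : 0 ≤ r) (φ : ℝ) : dist u (polarPt u r φ) = r := by
  simp [polarPt, dist_eq_norm, Complex.norm_exp_ofReal_mul_I, abs_of_nonneg hr]

theorem mem_yaoCone {k j : ℕ} (hk : 0 < k) {u v : ℂ} :
    v ∈ yaoCone (2 * k) j u ↔ ∃ r φ : ℝ, 0 < r ∧ (j : ℝ) * (Real.pi / k) ≤ φ ∧
      φ < ((j : ℝ) + 1) * (Real.pi / k) ∧ v = polarPt u r φ := by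
  have hk' : (k : ℝ) ≠ 0 := by positivity
  have h1 : 2 * (j : ℝ) * Real.pi / ((2 * k : ℕ) : ℝ) = (j : ℝ) * (Real.pi / k) := by
    push_cast; field_simp
  have h2 : 2 * ((j : ℝ) + 1) * Real.pi / ((2 * k : ℕ) : ℝ) = ((j : ℝ) + 1) * (Real.pi / k) := by
    push_cast; field_simp
  simp only [yaoCone, cone, Set.mem_ofPred_eq, h1, h2, polarPt]

theorem polar_unique {u : ℂ} {r r' φ φ' : ℝ} (hr : 0 < r) (hr' : 0 < r')
    (h : polarPt u r φ = polarPt u r' φ') : r = r' ∧ ∃ l : ℤ, φ = φ' + l * (2 * Real.pi) := by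
  have hrr : r = r' := by
    rw [← dist_polarPt u hr.le φ, h, dist_polarPt u hr'.le]
  subst hrr
  refine ⟨rfl, ?_⟩
  have h2 : Complex.exp ((φ : ℂ) * Complex.I) = Complex.exp ((φ' : ℂ) * Complex.I) := by
    have : (r : ℂ) ≠ 0 := by exact_mod_cast hr.ne'
    exact mul_left_cancel₀ this (add_left_cancel h)
  obtain ⟨l, hl⟩ := Complex.exp_eq_exp_iff_exists_int.1 h2
  refine ⟨l, ?_⟩
  have := congrArg Complex.im hl
  simpa using this

theorem yaoCone_index_unique {k i j : ℕ} (hk : 0 < k) {u v : ℂ} (hi : i < 2 * k) (hj : j < 2 * k)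
    (h : v ∈ yaoCone (2 * k) i u) (h' : v ∈ yaoCone (2 * k) j u) : i = j := by
  obtain ⟨r, φ, hr, h1, h2, rfl⟩ := (mem_yaoCone hk).1 h
  obtain ⟨r', φ', hr', h1', h2', he⟩ := (mem_yaoCone hk).1 h'
  obtain ⟨-, l, hl⟩ := polar_unique hr hr' he
  have hk' : (0 : ℝ) < k := by exact_mod_cast hk
  have ha : 0 < Real.pi / k := div_pos Real.pi_pos hk'
  have hpi : (2 * Real.pi) = (2 * k : ℕ) * (Real.pi / k) := by push_cast; field_simp
  rw [hpi] at hl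
  rw [hl] at h1 h2
  have e1 : (i : ℝ) < (j : ℝ) + 1 + l * (2 * k : ℕ) := by
    refine lt_of_mul_lt_mul_right ?_ ha.le
    nlinarith
  have e2 : (j : ℝ) + l * (2 * k : ℕ) < (i : ℝ) + 1 := by
    refine lt_of_mul_lt_mul_right ?_ ha.le
    nlinarith
  have e1' : (i : ℤ) < j + 1 + l * (2 * k : ℕ) := by exact_mod_cast e1
  have e2' : (j : ℤ) + l * (2 * k : ℕ) < i + 1 := by exact_mod_cast e2
  have hl0 : l = 0 := by
    rcases lt_trichotomy l 0 with h | h | h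
    · have : l * (2 * k : ℕ) ≤ -1 * (2 * k : ℕ) := by gcongr; omega
      omega
    · exact h
    · have : 1 * (2 * k : ℕ) ≤ l * (2 * k : ℕ) := by gcongr; omega
      omega
  subst hl0
  omega

theorem exists_yaoCone {k : ℕ} (hk : 0 < k) {u v : ℂ} (h : u ≠ v) :
    ∃ j < 2 * k, v ∈ yaoCone (2 * k) j u := by
  have hk' : (0 : ℝ) < k := by exact_mod_cast hk
  have ha : 0 < Real.pi / k := div_pos Real.pi_pos hk'
  obtain ⟨ψ, h0, h1, hψ⟩ : ∃ ψ : ℝ, 0 ≤ ψ ∧ ψ < 2 * Real.pi ∧ v = polarPt u ‖v - u‖ ψ := by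
    have hp : ∀ ψ : ℝ, Complex.exp (ψ * Complex.I) = Complex.exp (Complex.arg (v - u) * Complex.I) →
        v = polarPt u ‖v - u‖ ψ := by
      intro ψ hψ
      rw [polarPt, hψ, Complex.norm_mul_exp_arg_mul_I]; ring
    rcases le_or_gt 0 (Complex.arg (v - u)) with h | h
    · exact ⟨_, h, by linarith [Complex.arg_le_pi (v - u), Real.pi_pos], hp _ rfl⟩
    · refine ⟨Complex.arg (v - u) + 2 * Real.pi, by linarith [Complex.neg_pi_lt_arg (v - u), Real.pi_pos],
        by linarith, hp _ ?_⟩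
      push_cast
      rw [add_mul, Complex.exp_add, Complex.exp_two_pi_mul_I, mul_one]
  refine ⟨⌊ψ / (Real.pi / k)⌋₊, ?_, (mem_yaoCone hk).2 ⟨_, ψ, ?_, ?_, ?_, hψ⟩⟩
  · rw [Nat.floor_lt (by positivity), div_lt_iff₀ ha]
    push_cast
    calc ψ < 2 * Real.pi := h1
      _ = _ := by field_simp
  · exact norm_pos_iff.2 (sub_ne_zero.2 h.symm)
  · rw [← le_div_iff₀ ha]; exact Nat.floor_le (by positivity)
  · rw [← div_lt_iff₀ ha]; exact Nat.lt_floor_add_one _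

/-- Every Yao step from `u` towards the cone of `v` ends, after the reverse step, in an edge `w v'`
of `G` such that `v` and `v'` lie in the same cone of `u`, and `v'` in the parallel cone of `w`. -/
def StepProp (α : ℝ) (P : Finset ℂ) (G : SimpleGraph ℂ) : Prop :=
  ∀ u ∈ P, ∀ v ∈ P, u ≠ v → ∃ v' ∈ P, ∃ w ∈ P, ∃ (j : ℤ) (ψ ψ' η r r' δ : ℝ),
    (j * α ≤ ψ ∧ ψ < (j + 1) * α) ∧ (j * α ≤ ψ' ∧ ψ' < (j + 1) * α) ∧
    (j * α ≤ η ∧ η < (j + 1) * α) ∧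
    v = polarPt u r ψ ∧ v' = polarPt u r' ψ' ∧ v' = polarPt w δ η ∧
    0 < δ ∧ δ ≤ r' ∧ r' ≤ r ∧ Conn G w v' δ

theorem polarPt_flip (u : ℂ) (r φ : ℝ) (l : ℤ) (hl : Odd l) :
    u = polarPt (polarPt u r φ) r (φ + l * Real.pi) := by
  obtain ⟨m, rfl⟩ := hl
  have : Complex.exp (((φ + ((2 * m + 1 : ℤ) : ℝ) * Real.pi : ℝ) : ℂ) * Complex.I)
      = - Complex.exp ((φ : ℂ) * Complex.I) := by
    push_cast
    rw [show ((φ : ℂ) + (2 * m + 1) * Real.pi) * Complex.I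
        = (φ : ℂ) * Complex.I + (m * (2 * Real.pi * Complex.I) + Real.pi * Complex.I) by ring,
      Complex.exp_add, Complex.exp_add, Complex.exp_int_mul_two_pi_mul_I, Complex.exp_pi_mul_I]
    ring
  rw [polarPt, this, polarPt]; ring

/-- The number `2k` of cones is even, so a half-turn shifts indices by `k` and the cone opposite to
a cone is again one of the cones. -/
theorem mem_yaoCone_opposite {k j j' : ℕ} (hk : 0 < k) {u v : ℂ} {l : ℤ} (hl : Odd l)
    (hj : (j' : ℤ) = j + l * k) (h : v ∈ yaoCone (2 * k) j u) : u ∈ yaoCone (2 * k) j' v := by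
  obtain ⟨r, φ, hr, h1, h2, rfl⟩ := (mem_yaoCone hk).1 h
  have hk' : (0 : ℝ) < k := by exact_mod_cast hk
  have hj' : (j' : ℝ) = j + l * k := by exact_mod_cast hj
  have hpi : (k : ℝ) * (Real.pi / k) = Real.pi := by field_simp
  refine (mem_yaoCone hk).2 ⟨r, φ + l * Real.pi, hr, ?_, ?_, polarPt_flip u r φ l hl⟩
  · rw [hj', add_mul, mul_assoc, hpi]; linarith
  · rw [hj', add_assoc, add_comm _ (1 : ℝ), ← add_assoc, add_mul, mul_assoc, hpi]; linarith

theorem stepProp_of_isYaoYaoGraph {k : ℕ} (hk : 0 < k) {P : Finset ℂ} {Y E : ℂ → ℂ → Prop}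
    (hY : IsYaoGraph (2 * k) P Y) (hE : IsYaoYaoGraph (2 * k) P Y E) :
    StepProp (Real.pi / k) P (SimpleGraph.fromRel E) := by
  intro u hu v hv huv
  obtain ⟨j, hj, hvj⟩ := exists_yaoCone hk huv
  obtain ⟨v', ⟨hv'j, huv'⟩, -⟩ := hY.existsUnique u hu j hj ⟨v, hv, hvj, trivial⟩
  obtain ⟨-, hv', -, i, hi, hv'i, hmin⟩ := hY.nearest u v' huv'
  obtain rfl := yaoCone_index_unique hk hi hj hv'i hv'j
  obtain ⟨j', l, hl, hj', hjl⟩ : ∃ (j' : ℕ) (l : ℤ), Odd l ∧ j' < 2 * k ∧ (j' : ℤ) = i + l * k := by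
    rcases lt_or_ge i k with h | h
    · exact ⟨i + k, 1, by decide, by omega, by push_cast; ring⟩
    · exact ⟨i - k, -1, by decide, by omega, by push_cast [h]; ring⟩
  have huj' := mem_yaoCone_opposite hk hl hjl hv'i
  obtain ⟨w, ⟨hwj', hwv'⟩, -⟩ := hE.existsUnique v' hv' j' hj' ⟨u, hu, huj', huv'⟩
  obtain ⟨-, hw, -, i', hi', hwi', hmin'⟩ := hE.nearest v' w hwv'
  obtain rfl := yaoCone_index_unique hk hi' hj' hwi' hwj'
  have hv'w : v' ∈ yaoCone (2 * k) i w :=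
    mem_yaoCone_opposite hk (l := -l) hl.neg (by rw [hjl]; ring) hwj'
  have hd := hmin v hv hvj trivial
  have hd' := hmin' u hu huj' huv'
  obtain ⟨r, ψ, hr, h1, h2, rfl⟩ := (mem_yaoCone hk).1 hvj
  obtain ⟨r', ψ', hr', h1', h2', hp⟩ := (mem_yaoCone hk).1 hv'i
  obtain ⟨δ, η, hδ, h1'', h2'', hp'⟩ := (mem_yaoCone hk).1 hv'w
  have e1 : dist u v' = r' := by rw [hp, dist_polarPt _ hr'.le]
  have e2 : dist w v' = δ := by rw [hp', dist_polarPt _ hδ.le]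
  rw [e1, dist_polarPt _ hr.le] at hd
  rw [dist_comm, e2, dist_comm, e1] at hd'
  refine ⟨v', hv', w, hw, i, ψ, ψ', η, r, r', δ, ⟨by exact_mod_cast h1, by exact_mod_cast h2⟩,
    ⟨by exact_mod_cast h1', by exact_mod_cast h2'⟩, ⟨by exact_mod_cast h1'', by exact_mod_cast h2''⟩,
    rfl, hp, hp', hδ, hd', hd, ?_⟩
  rw [← e2]
  refine Conn.of_adj ?_
  rw [SimpleGraph.fromRel_adj]
  refine ⟨?_, Or.inl hwv'⟩
  rw [← dist_pos, e2]; exact hδ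

open ComplexConjugate

/-! ### Angles and constants -/

/-- `α` is the aperture of the cones, `θ` that of the sector of a trapezoid, and `A` the stretch
factor, large enough to compensate the losses of order `α`. -/
structure Setting (α θ A : ℝ) (k N : ℕ) : Prop where
  pos : 0 < α
  le : α ≤ 0.0748
  k_mul : k * α = Real.pi
  N_mul : θ = N * α
  ge_pi_div_four : Real.pi / 4 ≤ θ
  le_pi_div_four_add : θ ≤ Real.pi / 4 + 3 / 4 * α
  one_le : 1 ≤ A * (1 - 13.2 * α)

variable {α θ A : ℝ} {k N : ℕ}

namespace Setting

theorem A_pos (S : Setting α θ A k N) : 0 < A := by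
  have h1 := S.one_le
  have h2 := S.le
  by_contra h
  nlinarith

theorem theta_lt (S : Setting α θ A k N) : θ < 0.86 := by
  have := S.le_pi_div_four_add
  have := S.le
  have := Real.pi_lt_d4
  linarith

theorem theta_gt (S : Setting α θ A k N) : 0.78 < θ := by
  have := S.ge_pi_div_four
  have := Real.pi_gt_d4
  linarith

theorem theta_lt_pi_div_two (S : Setting α θ A k N) : θ < Real.pi / 2 := by
  have := S.theta_lt
  have := Real.pi_gt_d4
  linarith

theorem cos_theta_pos (S : Setting α θ A k N) : 0 < Real.cos θ :=
  Real.cos_pos_of_mem_Ioo ⟨by linarith [S.theta_gt, Real.pi_pos], S.theta_lt_pi_div_two⟩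

theorem sin_theta_pos (S : Setting α θ A k N) : 0 < Real.sin θ :=
  Real.sin_pos_of_pos_of_lt_pi (by linarith [S.theta_gt])
    (by linarith [S.theta_lt_pi_div_two, Real.pi_pos])

theorem cos_theta_le_sin_theta (S : Setting α θ A k N) : Real.cos θ ≤ Real.sin θ := by
  have h1 : Real.cos θ ≤ Real.cos (Real.pi / 4) :=
    Real.cos_le_cos_of_nonneg_of_le_pi (by linarith [Real.pi_pos])
      (by linarith [S.theta_lt_pi_div_two, Real.pi_pos]) S.ge_pi_div_four
  have h2 : Real.sin (Real.pi / 4) ≤ Real.sin θ :=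
    Real.sin_le_sin_of_le_of_le_pi_div_two (by linarith [Real.pi_pos])
      S.theta_lt_pi_div_two.le S.ge_pi_div_four
  rw [Real.cos_pi_div_four] at h1
  rw [Real.sin_pi_div_four] at h2
  exact h1.trans h2

theorem cos_theta_ge (S : Setting α θ A k N) : 0.66585 ≤ Real.cos θ := by
  have hp := Real.pi_pos
  -- Here `0.0561 = 3/4 · 0.0748` bounds the excess of `θ` over `π/4`.
  have h1 : Real.cos (Real.pi / 4 + 0.0561) ≤ Real.cos θ :=
    Real.cos_le_cos_of_nonneg_of_le_pi (by linarith [S.theta_gt])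
      (by linarith [Real.pi_gt_d4]) (by linarith [S.le_pi_div_four_add, S.le])
  rw [Real.cos_add, Real.cos_pi_div_four, Real.sin_pi_div_four] at h1
  have h2 := Real.one_sub_sq_div_two_le_cos (x := 0.0561)
  have h3 := Real.sin_le (x := 0.0561) (by norm_num)
  have h4 : (1.41421 : ℝ) ≤ √2 := Real.le_sqrt_of_sq_le (by norm_num)
  nlinarith

theorem sin_theta_le (S : Setting α θ A k N) : Real.sin θ ≤ 0.7468 := by
  have hp := Real.pi_pos
  have h1 : Real.sin θ ≤ Real.sin (Real.pi / 4 + 0.0561) :=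
    Real.sin_le_sin_of_le_of_le_pi_div_two (by linarith [S.theta_gt])
      (by linarith [Real.pi_gt_d4]) (by linarith [S.le_pi_div_four_add, S.le])
  rw [Real.sin_add, Real.cos_pi_div_four, Real.sin_pi_div_four] at h1
  have h2 := Real.cos_le_one 0.0561
  have h3 := Real.sin_le (x := 0.0561) (by norm_num)
  have h4 : √2 ≤ (1.414214 : ℝ) := Real.sqrt_le_iff.2 (by norm_num)
  have h5 : 0 ≤ √2 := Real.sqrt_nonneg 2
  nlinarith

theorem sin_alpha_le (S : Setting α θ A k N) : Real.sin α ≤ α := Real.sin_le S.pos.le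

theorem cos_alpha_ge (S : Setting α θ A k N) : 0.997 ≤ Real.cos α := by
  have h := Real.one_sub_sq_div_two_le_cos (x := α)
  nlinarith [S.pos, S.le]

theorem sin_alpha_ge (S : Setting α θ A k N) : 0.999 * α ≤ Real.sin α := by
  have h := Real.sin_gt_sub_cube S.pos
  have h2 : α ^ 3 ≤ 0.0748 ^ 2 * α := by
    have : α ^ 2 ≤ 0.0748 ^ 2 := by gcongr; exacts [S.pos.le, S.le]
    calc α ^ 3 = α ^ 2 * α := by ring
      _ ≤ _ := by gcongr; exact S.pos.le
  nlinarith [S.pos]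

end Setting

/-! ### Frames -/

/-- Coordinates of `z` in the frame with origin `u` and `x`-axis in the direction of the unit vector
`e`; the frame is negatively oriented if `σ = true`. -/
def frame (u e : ℂ) (σ : Bool) (z : ℂ) : ℂ :=
  cond σ (conj ((z - u) * conj e)) ((z - u) * conj e)

/-- The rotation by `φ`, counterclockwise as seen in a frame of orientation `σ`. -/
def spin (σ : Bool) (φ : ℝ) : ℂ :=
  cond σ (Complex.exp ((-φ : ℝ) * Complex.I)) (Complex.exp (φ * Complex.I))

/-- The directions of the boundaries of the cones. -/
def IsDir (α : ℝ) (e : ℂ) : Prop := ∃ j : ℤ, e = Complex.exp ((j * α : ℝ) * Complex.I)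

theorem IsDir.norm_eq_one {α : ℝ} {e : ℂ} (h : IsDir α e) : ‖e‖ = 1 := by
  obtain ⟨j, rfl⟩ := h
  exact Complex.norm_exp_ofReal_mul_I _

theorem IsDir.mul_spin {α : ℝ} {e : ℂ} (h : IsDir α e) (σ : Bool) (l : ℤ) :
    IsDir α (e * spin σ (l * α)) := by
  obtain ⟨j, rfl⟩ := h
  cases σ
  · refine ⟨j + l, ?_⟩
    simp only [spin, cond_false, ← Complex.exp_add]
    congr 1; push_cast; ring
  · refine ⟨j - l, ?_⟩
    simp only [spin, cond_true, ← Complex.exp_add]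
    congr 1; push_cast; ring

theorem IsDir.neg {α θ A : ℝ} {k N : ℕ} (S : Setting α θ A k N) {e : ℂ} (h : IsDir α e) :
    IsDir α (-e) := by
  obtain ⟨j, rfl⟩ := h
  refine ⟨j + k, ?_⟩
  have : (((j + k : ℤ) : ℝ) * α : ℝ) = j * α + Real.pi := by
    push_cast; rw [add_mul, S.k_mul]
  rw [this]
  push_cast
  rw [add_mul, Complex.exp_add, Complex.exp_pi_mul_I]; ring

theorem frame_self (u e : ℂ) (σ : Bool) : frame u e σ u = 0 := by
  cases σ <;> simp [frame]

theorem frame_sub (u e : ℂ) (σ : Bool) (y z : ℂ) :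
    frame y e σ z = frame u e σ z - frame u e σ y := by
  cases σ <;> simp [frame] <;> ring

theorem frame_not (u e : ℂ) (σ : Bool) (z : ℂ) : frame u e (!σ) z = conj (frame u e σ z) := by
  cases σ <;> simp [frame]

theorem frame_neg (u e : ℂ) (σ : Bool) (z : ℂ) : frame u (-e) σ z = -frame u e σ z := by
  cases σ <;> simp [frame]

theorem frame_flip (u e : ℂ) (σ : Bool) (y z : ℂ) :
    frame y (-e) (!σ) z = -conj (frame u e σ z - frame u e σ y) := by
  rw [frame_neg, frame_not, frame_sub u e σ y z]

theorem frame_mul_spin (u e : ℂ) (σ : Bool) (φ : ℝ) (z : ℂ) :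
    frame u (e * spin σ φ) σ z = frame u e σ z * Complex.exp ((-φ : ℝ) * Complex.I) := by
  cases σ
  · simp [frame, spin, ← Complex.exp_conj]; ring
  · simp [frame, spin]; ring

theorem norm_frame {e : ℂ} (he : ‖e‖ = 1) (u : ℂ) (σ : Bool) (z : ℂ) :
    ‖frame u e σ z‖ = dist u z := by
  cases σ <;> simp only [frame, cond_true, cond_false, RCLike.norm_conj, norm_mul, he, mul_one,
    dist_comm u z, dist_eq_norm]

theorem frame_inj {e : ℂ} (he : ‖e‖ = 1) {u : ℂ} {σ : Bool} {y z : ℂ}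
    (h : frame u e σ y = frame u e σ z) : y = z := by
  rw [← dist_eq_zero, ← norm_frame he y σ z, frame_sub u e σ y z, h, sub_self, norm_zero]

theorem norm_frame_sub {e : ℂ} (he : ‖e‖ = 1) (u : ℂ) (σ : Bool) (y z : ℂ) :
    ‖frame u e σ z - frame u e σ y‖ = dist y z := by
  rw [← frame_sub, norm_frame he]

/-- The trapezoid of size `L`, with its bottom side. -/
def InTrap (θ L : ℝ) (ζ : ℂ) : Prop :=
  0 ≤ ζ.im ∧ ζ.im < L * Real.sin θ ∧ ‖ζ‖ < L ∧ ‖ζ - L‖ < L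

theorem norm_lt_iff_sq {ζ : ℂ} {L : ℝ} (hL : 0 ≤ L) : ‖ζ‖ < L ↔ ζ.re ^ 2 + ζ.im ^ 2 < L ^ 2 := by
  rw [← sq_lt_sq₀ (norm_nonneg ζ) hL, Complex.sq_norm, Complex.normSq_apply]
  ring_nf

theorem norm_le_iff_sq {ζ : ℂ} {L : ℝ} (hL : 0 ≤ L) : ‖ζ‖ ≤ L ↔ ζ.re ^ 2 + ζ.im ^ 2 ≤ L ^ 2 := by
  rw [← sq_le_sq₀ (norm_nonneg ζ) hL, Complex.sq_norm, Complex.normSq_apply]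
  ring_nf

theorem sq_norm_eq (ζ : ℂ) : ‖ζ‖ ^ 2 = ζ.re ^ 2 + ζ.im ^ 2 := by
  rw [Complex.sq_norm, Complex.normSq_apply]; ring

theorem norm_sub_lt_iff {ζ : ℂ} {L : ℝ} (hL : 0 ≤ L) :
    ‖ζ - L‖ < L ↔ ζ.re ^ 2 + ζ.im ^ 2 < 2 * L * ζ.re := by
  rw [norm_lt_iff_sq hL]
  simp only [Complex.sub_re, Complex.ofReal_re, Complex.sub_im, Complex.ofReal_im]
  constructor <;> intro h <;> nlinarith

theorem inTrap_iff {θ L : ℝ} {ζ : ℂ} (hL : 0 ≤ L) : InTrap θ L ζ ↔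
    0 ≤ ζ.im ∧ ζ.im < L * Real.sin θ ∧ ζ.re ^ 2 + ζ.im ^ 2 < L ^ 2 ∧
      ζ.re ^ 2 + ζ.im ^ 2 < 2 * L * ζ.re := by
  rw [InTrap, norm_lt_iff_sq hL, norm_sub_lt_iff hL]

/-- A nonzero point of the sector of aperture `θ` in polar coordinates. -/
theorem exists_polar_of_sector {θ : ℝ} (h0 : 0 < θ) {ζ : ℂ} (hζ : 0 < ‖ζ‖)
    (him : 0 ≤ ζ.im) (hs : ζ.im * Real.cos θ ≤ ζ.re * Real.sin θ) :
    ∃ φ : ℝ, 0 ≤ φ ∧ φ ≤ θ ∧ ζ = ‖ζ‖ * Complex.exp (φ * Complex.I) ∧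
      ζ.im = ‖ζ‖ * Real.sin φ ∧ (ζ.im * Real.cos θ < ζ.re * Real.sin θ → φ < θ) := by
  have e := Complex.norm_mul_exp_arg_mul_I ζ
  have hre : ζ.re = ‖ζ‖ * Real.cos ζ.arg := by
    rw [Complex.norm_mul_cos_arg]
  have himm : ζ.im = ‖ζ‖ * Real.sin ζ.arg := by
    rw [Complex.norm_mul_sin_arg]
  have harg := Complex.arg_nonneg_iff.2 him
  have hsub : ζ.re * Real.sin θ - ζ.im * Real.cos θ = ‖ζ‖ * Real.sin (θ - ζ.arg) := by
    rw [Real.sin_sub]; linear_combination Real.sin θ * hre - Real.cos θ * himm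
  have hle : ζ.arg ≤ θ := by
    by_contra hlt
    push Not at hlt
    have hn : Real.sin (θ - ζ.arg) < 0 :=
      Real.sin_neg_of_neg_of_neg_pi_lt (by linarith) (by linarith [Complex.arg_le_pi ζ])
    nlinarith
  refine ⟨ζ.arg, harg, hle, e.symm, himm, fun h => ?_⟩
  rcases hle.eq_or_lt with hθ | hθ
  · rw [hθ, sub_self, Real.sin_zero, mul_zero] at hsub
    linarith
  · exact hθ

/-! ### Pairs at small distance -/

/-- The bound to be proved for `u` and `v` if `v` is the first point hit by the critical arc of a
growing trapezoid attached to `u`. -/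
def EdgeOK (α θ A : ℝ) (P : Finset ℂ) (G : SimpleGraph ℂ) (u v : ℂ) : Prop :=
  ∀ (e : ℂ) (σ : Bool) (φ : ℝ), IsDir α e → 0 ≤ φ → φ ≤ θ → (φ < θ ∨ σ = true) →
    frame u e σ v = dist u v * Complex.exp (φ * Complex.I) →
    (∀ z ∈ P, ¬ InTrap θ (dist u v) (frame u e σ z)) →
    Conn G u v (A * dist u v + 3 * A * dist u v * min (Real.sin φ) (Real.sin α))

/-- `EdgeOK` for a point given by Cartesian coordinates. -/
theorem EdgeOK.conn {α θ A : ℝ} {P : Finset ℂ} {G : SimpleGraph ℂ} {u v e : ℂ} {σ : Bool}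
    (h : EdgeOK α θ A P G u v) (hθ : 0 < θ) (he : IsDir α e) (huv : u ≠ v)
    (him : 0 ≤ (frame u e σ v).im)
    (hs : (frame u e σ v).im * Real.cos θ ≤ (frame u e σ v).re * Real.sin θ)
    (hs' : (frame u e σ v).im * Real.cos θ < (frame u e σ v).re * Real.sin θ ∨ σ = true)
    (hT : ∀ z ∈ P, ¬ InTrap θ (dist u v) (frame u e σ z)) :
    Conn G u v (A * dist u v + 3 * A * min (frame u e σ v).im (dist u v * Real.sin α)) := by
  have hn := norm_frame he.norm_eq_one u σ v
  obtain ⟨φ, h0, h1, h2, h3, h4⟩ := exists_polar_of_sector hθ (by rw [hn]; exact dist_pos.2 huv) him hs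
  rw [hn] at h2 h3
  refine (h e σ φ he h0 h1 (hs'.imp_left h4) h2 hT).mono ?_
  rw [h3, ← mul_min_of_nonneg _ _ dist_nonneg]
  apply le_of_eq; ring

/-- The wedge of half-aperture `θ` around the positive `x`-axis. -/
def InWedge (θ : ℝ) (ζ : ℂ) : Prop := |ζ.im| * Real.cos θ ≤ ζ.re * Real.sin θ

/-- The left side is a chord subtending an angle of at most `θ`, so it is at most `√(2 - 2 cos θ)
‖ζ‖`, and `2 - 2 · 0.66585 ≤ 0.8175²`. -/
theorem InWedge.norm_sub_le (S : Setting α θ A k N) {ζ : ℂ} (h : InWedge θ ζ) :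
    ‖ζ - ‖ζ‖‖ ≤ 0.8175 * ‖ζ‖ := by
  have hc := S.cos_theta_pos
  have hs := S.sin_theta_pos
  have h' : |ζ.im| * Real.cos θ ≤ ζ.re * Real.sin θ := h
  have hre : 0 ≤ ζ.re := by
    have : 0 ≤ ζ.re * Real.sin θ := le_trans (by positivity) h'
    exact nonneg_of_mul_nonneg_left this hs
  have hn := sq_norm_eq ζ
  have h0 := norm_nonneg ζ
  have hre' : ‖ζ‖ * Real.cos θ ≤ ζ.re := by
    refine abs_le_of_sq_le_sq' ?_ hre |>.2
    have h2 : (|ζ.im| * Real.cos θ) ^ 2 ≤ (ζ.re * Real.sin θ) ^ 2 := by gcongr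
    rw [mul_pow, mul_pow, sq_abs] at h2
    have := Real.sin_sq_add_cos_sq θ
    have e : Real.sin θ ^ 2 = 1 - Real.cos θ ^ 2 := by linarith
    rw [e] at h2
    nlinarith
  rw [norm_le_iff_sq (by positivity)]
  simp only [Complex.sub_re, Complex.ofReal_re, Complex.sub_im, Complex.ofReal_im]
  have h3 : ‖ζ‖ * 0.66585 ≤ ζ.re := le_trans (by gcongr; exact S.cos_theta_ge) hre'
  nlinarith

/-- Triangle inequality through the point `‖ζ‖` of the real axis and the copy of `ξ` rescaled to
norm `‖ζ‖`. -/
theorem norm_sub_le_of_directions {ζ ξ : ℂ} {a b : ℝ} (hζ : ‖ζ - ‖ζ‖‖ ≤ a * ‖ζ‖)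
    (hξ : ‖ξ - ‖ξ‖‖ ≤ b * ‖ξ‖) (h : ‖ζ‖ ≤ ‖ξ‖) (h0 : 0 < ‖ξ‖) :
    ‖ζ - ξ‖ ≤ ‖ξ‖ - ‖ζ‖ + (a + b) * ‖ζ‖ := by
  set r := ‖ζ‖
  set d := ‖ξ‖
  have e : ζ - ξ = (ζ - r) - ((r / d : ℝ) : ℂ) * (ξ - d) - ((1 - r / d : ℝ) : ℂ) * ξ := by
    have : (d : ℂ) ≠ 0 := by exact_mod_cast h0.ne'
    push_cast; field_simp; ring
  have hr : 0 ≤ r := norm_nonneg ζ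
  have h1 : r / d ≤ 1 := (div_le_one h0).2 h
  rw [e]
  calc _ ≤ ‖ζ - r‖ + ‖((r / d : ℝ) : ℂ) * (ξ - d)‖ + ‖((1 - r / d : ℝ) : ℂ) * ξ‖ :=
        (norm_sub_le _ _).trans (add_le_add_left (norm_sub_le _ _) _)
    _ ≤ a * r + r / d * (b * d) + (1 - r / d) * d := by
        rw [norm_mul, norm_mul, Complex.norm_real, Complex.norm_real, Real.norm_of_nonneg (by positivity),
          Real.norm_of_nonneg (by linarith)]
        gcongr
    _ = _ := by field_simp; ring

theorem norm_mul_exp_sub_le {d x : ℝ} (hd : 0 ≤ d) :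
    ‖(d : ℂ) * Complex.exp (x * Complex.I) - d‖ ≤ |x| * d := by
  have : (d : ℂ) * Complex.exp (x * Complex.I) - d = d * (Complex.exp (Complex.I * x) - 1) := by
    rw [mul_comm (x : ℂ)]; ring
  rw [this, norm_mul, Complex.norm_real, Real.norm_of_nonneg hd, mul_comm]
  gcongr
  exact Real.norm_exp_I_mul_ofReal_sub_one_le

/-- Some point of the wedge around the direction of `q` is joined to `p` by an edge of the
trapezoidal graph and is closer to `q`. -/
theorem exists_edge_towards (S : Setting α θ A k N) {P : Finset ℂ} {G : SimpleGraph ℂ} {p q : ℂ}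
    (hp : p ∈ P) (hq : q ∈ P) (hpq : p ≠ q)
    (hE : ∀ z ∈ P, dist p z ≤ dist p q → EdgeOK α θ A P G p z) :
    ∃ z ∈ P, 0 < dist p z ∧ dist p z ≤ dist p q ∧ Conn G p z (A * (1 + 3 * α) * dist p z) ∧
      dist z q ≤ dist p q - dist p z + (0.8175 + α / 2) * dist p z := by
  have hα := S.pos
  have hα' := S.le
  have hcθ := S.cos_theta_pos
  have hsθ := S.sin_theta_pos
  have hcs := S.cos_theta_le_sin_theta
  have hA := S.A_pos
  -- The boundary direction nearest to the direction of `q` is off by at most half a cone.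
  obtain ⟨l, x, hx, hxq⟩ : ∃ (l : ℤ) (x : ℝ), |x| ≤ α / 2 ∧
      frame p (Complex.exp ((l * α : ℝ) * Complex.I)) false q
        = dist p q * Complex.exp (x * Complex.I) := by
    refine ⟨round (Complex.arg (q - p) / α),
      Complex.arg (q - p) - round (Complex.arg (q - p) / α) * α, ?_, ?_⟩
    · have h := abs_sub_round (Complex.arg (q - p) / α)
      have e : Complex.arg (q - p) - round (Complex.arg (q - p) / α) * α
          = (Complex.arg (q - p) / α - round (Complex.arg (q - p) / α)) * α := by
        field_simp
      rw [e, abs_mul, abs_of_pos hα]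
      nlinarith
    · rw [frame, cond_false, dist_comm, dist_eq_norm]
      nth_rewrite 1 [← Complex.norm_mul_exp_arg_mul_I (q - p)]
      rw [← Complex.exp_conj, mul_assoc, ← Complex.exp_add]
      congr 2
      simp
      ring
  set e := Complex.exp ((l * α : ℝ) * Complex.I) with he
  have heD : IsDir α e := ⟨l, he⟩
  have hen := heD.norm_eq_one
  set F := frame p e false with hF
  have hd0 : 0 < dist p q := dist_pos.2 hpq
  have hqW : InWedge θ (F q) := by
    rw [InWedge, hxq]
    have h1 : |Real.sin x| ≤ α / 2 := (Real.abs_sin_le_abs).trans hx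
    have h2 := Real.one_sub_sq_div_two_le_cos (x := x)
    have h3 : x ^ 2 ≤ (α / 2) ^ 2 := by rw [← sq_abs]; gcongr
    have h4 : |Real.sin x| ≤ Real.cos x := by nlinarith
    simp only [Complex.re_ofReal_mul, Complex.im_ofReal_mul, Complex.exp_ofReal_mul_I_re,
      Complex.exp_ofReal_mul_I_im, abs_mul, abs_of_pos hd0]
    have h5 : 0 ≤ |Real.sin x| := abs_nonneg _
    rw [mul_assoc, mul_assoc]
    gcongr
    exact h5.trans h4
  classical
  obtain ⟨z, hz, hmin⟩ := Finset.exists_min_image (P.filter fun z => z ≠ p ∧ InWedge θ (F z))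
    (fun z => dist p z) ⟨q, by simp [hq, hpq.symm, hqW]⟩
  simp only [Finset.mem_filter] at hz hmin
  obtain ⟨hzP, hzp, hzW⟩ := hz
  have hdz : dist p z ≤ dist p q := hmin q ⟨hq, hpq.symm, hqW⟩
  have hFz : ‖F z‖ = dist p z := norm_frame hen _ _ _
  have hFq : ‖F q‖ = dist p q := norm_frame hen _ _ _
  refine ⟨z, hzP, dist_pos.2 hzp.symm, hdz, ?_, ?_⟩
  -- The orientation puts `z` into the lower half of the wedge, whose lower boundary ray then serves
  -- as axis of the trapezoid. A point `z` on the middle ray gets angle exactly `θ`, which `EdgeOK`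
  -- allows only for `σ = true`; hence the non-strict inequality.
  · set σ : Bool := decide (0 ≤ (F z).im) with hσ
    have hFσ : ∀ y, (frame p e σ y).re = (F y).re ∧ |(frame p e σ y).im| = |(F y).im| := by
      intro y
      cases σ
      · exact ⟨rfl, rfl⟩
      · have := frame_not p e false y
        rw [Bool.not_false] at this
        rw [this]; simp [hF]
    have hzim : (frame p e σ z).im ≤ 0 ∧ ((frame p e σ z).im < 0 ∨ σ = true) := by
      by_cases h : 0 ≤ (F z).im
      · have hσ' : σ = true := by simp [hσ, h]
        rw [hσ']
        have := frame_not p e false z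
        rw [Bool.not_false] at this
        rw [this]
        simpa [hF] using h
      · have hσ' : σ = false := by simp [hσ, h]
        rw [hσ']
        push Not at h
        exact ⟨h.le, Or.inl h⟩
    set e' := e * spin σ ((-N : ℤ) * α) with he'
    have heD' : IsDir α e' := heD.mul_spin σ (-N)
    have hrot : ∀ y, (frame p e' σ y).re
          = (F y).re * Real.cos θ - (frame p e σ y).im * Real.sin θ ∧
        (frame p e' σ y).im = (F y).re * Real.sin θ + (frame p e σ y).im * Real.cos θ := by
      intro y
      rw [he', frame_mul_spin, ← (hFσ y).1]
      have : (-(((-N : ℤ) : ℝ) * α) : ℝ) = θ := by rw [S.N_mul]; push_cast; ring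
      rw [this, Complex.mul_re, Complex.mul_im, Complex.exp_ofReal_mul_I_re,
        Complex.exp_ofReal_mul_I_im]
      exact ⟨rfl, by ring⟩
    have hsc := Real.sin_sq_add_cos_sq θ
    obtain ⟨hzre', hzim'⟩ := hrot z
    have hle : (frame p e' σ z).re * Real.sin θ - (frame p e' σ z).im * Real.cos θ
        = -(frame p e σ z).im := by
      rw [hzre', hzim']; linear_combination (-(frame p e σ z).im) * hsc
    have hzW' : |(F z).im| * Real.cos θ ≤ (F z).re * Real.sin θ := hzW
    rw [← (hFσ z).2] at hzW'
    have him : 0 ≤ (frame p e' σ z).im := by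
      rw [hzim']
      have := neg_abs_le (frame p e σ z).im
      nlinarith
    refine ((hE z hzP hdz).conn (by linarith [S.theta_gt]) heD' hzp.symm him (by linarith [hzim.1])
      (hzim.2.imp_left fun h => by linarith) ?_).mono ?_
    · intro y hy hT
      obtain ⟨t1, t2, t3, t4⟩ := (inTrap_iff dist_nonneg).1 hT
      have hdpos : 0 < dist p z := dist_pos.2 hzp.symm
      have hre : 0 < (frame p e' σ y).re := by
        have : 0 < 2 * dist p z * (frame p e' σ y).re := lt_of_le_of_lt (by positivity) t4
        exact pos_of_mul_pos_right this (by positivity)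
      -- The trapezoid lies above the lower ray and to the right of `p`, hence at angles below `π/2
      -- ≤ 2θ` from that ray, inside the wedge. By minimality of `z` it is empty.
      have hyW : InWedge θ (F y) := by
        rw [InWedge, ← (hFσ y).2, ← abs_of_pos hcθ, ← abs_mul, abs_le]
        obtain ⟨a1, a2⟩ := hrot y
        constructor
        · rw [a2] at t1; linarith
        · have e1 : (F y).re * Real.sin θ - (frame p e σ y).im * Real.cos θ
              = 2 * (frame p e' σ y).re * Real.sin θ * Real.cos θ
                + (frame p e' σ y).im * (Real.sin θ ^ 2 - Real.cos θ ^ 2) := by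
            rw [a1, a2]; linear_combination (-(F y).re * Real.sin θ
              + (frame p e σ y).im * Real.cos θ) * hsc
          have e2 : 0 ≤ Real.sin θ ^ 2 - Real.cos θ ^ 2 := by nlinarith
          have e3 : 0 ≤ 2 * (frame p e' σ y).re * Real.sin θ * Real.cos θ := by positivity
          have e4 := mul_nonneg t1 e2
          linarith
      have hyp : y ≠ p := by
        rintro rfl
        rw [frame_self] at hre
        simp at hre
      have h1 := hmin y ⟨hy, hyp, hyW⟩
      have h2 : dist p y < dist p z := by
        rw [← norm_frame heD'.norm_eq_one p σ y]; exact hT.2.2.1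
      linarith
    · have h1 : min (frame p e' σ z).im (dist p z * Real.sin α) ≤ dist p z * α :=
        (min_le_right _ _).trans (by gcongr; exact S.sin_alpha_le)
      nlinarith
  · have h := norm_sub_le_of_directions (a := 0.8175) (b := α / 2) (ζ := F z) (ξ := F q)
      (hzW.norm_sub_le S) ?_ (by rw [hFz, hFq]; exact hdz) (by rw [hFq]; exact hd0)
    · rw [hFz, hFq] at h
      rwa [hF, norm_frame_sub hen, dist_comm q z] at h
    · rw [hFq, hxq]
      exact (norm_mul_exp_sub_le dist_nonneg).trans (by gcongr)

/-- Pairs at distance less than `L` are connected with stretch `8.5 A`, provided that the edges of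
the trapezoidal graph of length less than `L` are. -/
theorem conn_of_dist_lt (S : Setting α θ A k N) {P : Finset ℂ} {G : SimpleGraph ℂ} {L : ℝ}
    (hE : ∀ p ∈ P, ∀ q ∈ P, dist p q < L → EdgeOK α θ A P G p q) :
    ∀ p ∈ P, ∀ q ∈ P, dist p q < L → Conn G p q (8.5 * A * dist p q) := by
  refine dist_induction P _ fun p hp q hq ih hL => ?_
  rcases eq_or_ne p q with rfl | hpq
  · exact Conn.refl _ (by simp)
  have hα := S.pos
  have hα' := S.le
  have hA := S.A_pos
  obtain ⟨z, hz, h0, h1, h2, h3⟩ := exists_edge_towards S hp hq hpq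
    fun z hz hd => hE p hp z hz (hd.trans_lt hL)
  have h4 : dist z q < dist p q := by nlinarith
  refine (h2.trans (ih z hz q hq h4 (h4.trans hL))).mono ?_
  -- The factor `8.5` is chosen so that `8.5 (1 - 0.8175 - α/2) ≥ 1 + 3α` for `α ≤ 0.0748`.
  have h5 : A * dist z q ≤ A * (dist p q - dist p z + (0.8175 + α / 2) * dist p z) := by gcongr
  have h6 : 0 < A * dist p z := by positivity
  nlinarith

/-! ### Points below an empty trapezoid -/

/-- A point `(x, y)` of the trapezoid attached to `(s, -ε)` that points to the origin and has the
origin on its critical arc. -/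
theorem trap_towards_origin {s ε r R c x y : ℝ} (hε : 0 ≤ ε) (hs : ε < s) (hr : 0 < r)
    (hn : s ^ 2 + ε ^ 2 = r ^ 2) (hsr : s ≤ r) (hsR : s ≤ R) (hrR : r ≤ R) (hc : 0 ≤ c)
    (t2 : y + ε < r * c) (t3 : (s - x) ^ 2 + (y + ε) ^ 2 < r ^ 2)
    (t4 : (s - x) ^ 2 + (y + ε) ^ 2 < 2 * r * (s - x)) :
    x < s ∧ (0 < y → y < R * c ∧ x ^ 2 + y ^ 2 < R ^ 2 ∧ x ^ 2 + y ^ 2 < 2 * R * x) ∧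
      (-ε ≤ y → y ≤ 0 → y ≤ x ∧ x ^ 2 + y ^ 2 ≤ r ^ 2) := by
  have hx : x < s := by
    have : 0 < 2 * r * (s - x) := lt_of_le_of_lt (by positivity) t4
    have := pos_of_mul_pos_right this (by positivity)
    linarith
  refine ⟨hx, fun hy => ?_, fun hy' hy => ?_⟩
  -- Above the axis, the disc around `(s, -ε)` is contained in a disc through the origin centred on
  -- the axis (`h1`), and the disc around `(s - r, -ε)` in the disc of radius `R` around the origin
  -- (`h3`, `h4`, `h5`).
  · have h1 : x ^ 2 + y ^ 2 + 2 * (y * ε) < 2 * s * x := by nlinarith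
    have h2 : 0 ≤ y * ε := by positivity
    have hx0 : 0 < x := by
      have : 0 < 2 * s * x := by nlinarith [sq_nonneg x, sq_nonneg y]
      exact pos_of_mul_pos_right this (by linarith)
    refine ⟨?_, ?_, ?_⟩
    · have : r * c ≤ R * c := by gcongr
      linarith
    · have h3 : (x + (r - s)) ^ 2 + (y + ε) ^ 2 < r ^ 2 := by nlinarith
      have h4 : x ^ 2 ≤ (x + (r - s)) ^ 2 := by gcongr; linarith
      have h5 : y ^ 2 ≤ (y + ε) ^ 2 := by gcongr; linarith
      have h6 : r ^ 2 ≤ R ^ 2 := by gcongr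
      linarith
    · have : s * x ≤ R * x := by gcongr
      linarith
  · have hxy : y ≤ x := by
      by_contra h
      push Not at h
      have h1 : (s - y) ^ 2 ≤ (s - x) ^ 2 := by
        gcongr
        linarith
      have h2 : 0 ≤ (-y) * (s - ε - y) := mul_nonneg (by linarith) (by linarith)
      nlinarith
    refine ⟨hxy, ?_⟩
    have h1 : y ^ 2 ≤ ε ^ 2 := sq_le_sq' hy' (by linarith)
    have h2 : x ^ 2 ≤ s ^ 2 := sq_le_sq' (by linarith) hx.le
    linarith

set_option maxHeartbeats 400000 in
/-- A point `y` below the bottom side of an empty trapezoid attached to `u` is joined to `u` by an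
almost straight path. -/
theorem conn_of_below (S : Setting α θ A k N) {P : Finset ℂ} {G : SimpleGraph ℂ} {L R : ℝ}
    (hE : ∀ p ∈ P, ∀ q ∈ P, dist p q < L → EdgeOK α θ A P G p q)
    {u e : ℂ} {σ : Bool} (hu : u ∈ P) (he : IsDir α e)
    (hD : ∀ z ∈ P, 0 < (frame u e σ z).im → ¬ InTrap θ R (frame u e σ z)) :
    ∀ y ∈ P, (frame u e σ y).im ≤ 0 → (frame u e σ y).im ≤ (frame u e σ y).re →
      (frame u e σ y).re ≤ R → dist u y ≤ R → dist u y < L →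
      Conn G y u (A * (frame u e σ y).re + 13.03 * A * (-(frame u e σ y).im)) := by
  have hspan := conn_of_dist_lt S hE
  have hA := S.A_pos
  have hcθ := S.cos_theta_pos
  have hsθ := S.sin_theta_pos
  have hcs := S.cos_theta_le_sin_theta
  have hen := he.norm_eq_one
  set F := frame u e σ with hF
  -- The walk moves strictly to the left, so the induction is on the number of points to the left of
  -- `y`.
  have key : ∀ n : ℕ, ∀ y ∈ P, (P.filter fun z => (F z).re < (F y).re).card = n →
      (F y).im ≤ 0 → (F y).im ≤ (F y).re → (F y).re ≤ R → dist u y ≤ R → dist u y < L →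
      Conn G y u (A * (F y).re + 13.03 * A * (-(F y).im)) := by
    intro n
    induction n using Nat.strong_induction_on with
    | _ n ih =>
    intro y hy hn him hre hR hR' hL
    have hnorm : (F y).re ^ 2 + (F y).im ^ 2 = dist u y ^ 2 := by
      rw [← sq_norm_eq, hF, norm_frame hen]
    set s := (F y).re with hs
    obtain ⟨ε, hε⟩ : ∃ ε, ε = -(F y).im := ⟨_, rfl⟩
    have him' : (F y).im = -ε := by rw [hε]; ring
    rw [him'] at hnorm him hre ⊢
    rw [neg_sq] at hnorm
    rw [neg_neg]
    have hε0 : 0 ≤ ε := by linarith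
    set r := dist u y with hr
    have hr0 : 0 ≤ r := dist_nonneg
    have hyu : dist y u = r := dist_comm _ _
    -- If `u` is seen at a steep angle, the crude stretch costs `8.5 √2 A ε < 12.03 A ε`. Since `s ≥
    -- -ε`, one more `ε` is needed, which gives `13.03`.
    rcases le_or_gt s ε with hsε | hsε
    · refine (hspan y hy u hu (by rwa [hyu])).mono ?_
      rw [hyu]
      have h1 : r ≤ 1.4143 * ε := by
        refine abs_le_of_sq_le_sq' ?_ (by linarith) |>.2
        nlinarith
      have h2 := mul_le_mul_of_nonneg_left h1 hA.le
      have h3 := mul_le_mul_of_nonneg_left hre hA.le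
      have h4 := mul_nonneg hA.le hε0
      linarith
    -- the trapezoid attached to `y` that points to `u`
    have hs0 : 0 < s := by linarith
    have hrpos : 0 < r := by
      rcases hr0.eq_or_lt with h | h
      · rw [← h] at hnorm; nlinarith only [hnorm, hs0, sq_nonneg ε]
      · exact h
    have hsr : s ≤ r := abs_le_of_sq_le_sq' (by nlinarith only [hnorm, sq_nonneg ε]) hr0 |>.2
    have hrs : r ≤ s + ε :=
      abs_le_of_sq_le_sq' (by nlinarith only [hnorm, mul_nonneg hs0.le hε0]) (by linarith) |>.2
    have heN := he.neg S
    have hyu' : y ≠ u := by rw [← dist_pos, hyu]; exact hrpos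
    set F' := frame y (-e) (!σ) with hF'
    have hF're : ∀ z, (F' z).re = s - (F z).re := by
      intro z; rw [hF', frame_flip u]; simp [hs, hF]
    have hF'im : ∀ z, (F' z).im = (F z).im + ε := by
      intro z; rw [hF', frame_flip u]; simp [hF, hε, add_comm]
    have hFu : F u = 0 := frame_self _ _ _
    -- The part of this trapezoid above the axis lies in the empty trapezoid of `u`. Its points are
    -- thus no lower than `y`, to its left, and again satisfy the hypotheses of the induction.
    have below : ∀ z ∈ P, InTrap θ r (F' z) → (F z).im ≤ 0 ∧ -ε ≤ (F z).im ∧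
        (F z).im ≤ (F z).re ∧ (F z).re < s ∧ dist u z ≤ r := by
      intro z hz hT
      obtain ⟨t1, t2, t3, t4⟩ := (inTrap_iff hr0).1 hT
      rw [hF're, hF'im] at t3 t4
      rw [hF'im] at t1 t2
      obtain ⟨c1, c2, c3⟩ := trap_towards_origin (by linarith) hsε hrpos (by linarith) hsr hR hR'
        hsθ.le t2 t3 t4
      have hY : (F z).im ≤ 0 := by
        by_contra hY
        push Not at hY
        obtain ⟨d1, d2, d3⟩ := c2 hY
        exact hD z hz hY ((inTrap_iff (by linarith)).2 ⟨hY.le, d1, d2, d3⟩)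
      obtain ⟨d1, d2⟩ := c3 (by linarith) hY
      refine ⟨hY, by linarith, d1, c1, ?_⟩
      rwa [← norm_frame hen u σ z, norm_le_iff_sq hr0]
    have next : ∀ z ∈ P, InTrap θ r (F' z) →
        Conn G z u (A * (F z).re + 13.03 * A * (-(F z).im)) := by
      intro z hz hT
      obtain ⟨b1, b2, b3, b4, b5⟩ := below z hz hT
      refine ih _ ?_ z hz rfl b1 b3 (by linarith) (by linarith) (by linarith)
      rw [← hn]
      refine Finset.card_lt_card (Finset.ssubset_iff_of_subset ?_ |>.2 ⟨z, ?_, ?_⟩)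
      · intro x hx
        simp only [Finset.mem_filter] at hx ⊢
        exact ⟨hx.1, hx.2.trans b4⟩
      · simp [hz, b4]
      · simp
    have norm' : ∀ z, dist y z ^ 2 = (s - (F z).re) ^ 2 + ((F z).im + ε) ^ 2 := by
      intro z
      rw [← norm_frame heN.norm_eq_one y (!σ) z, sq_norm_eq, ← hF', hF're, hF'im]
    -- A point at angle `θ` or more is not covered by `EdgeOK` for both orientations, but the crude
    -- connection to it is paid for by the rise alone.
    by_cases hsteep : ∃ z ∈ P, InTrap θ r (F' z) ∧
        (F' z).re * Real.sin θ ≤ (F' z).im * Real.cos θ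
    · obtain ⟨z, hz, hT, hst⟩ := hsteep
      obtain ⟨b1, b2, b3, b4, b5⟩ := below z hz hT
      have hdz : dist y z < r := by
        rw [← norm_frame heN.norm_eq_one y (!σ) z]; exact hT.2.2.1
      refine ((hspan y hy z hz (hdz.trans hL)).trans (next z hz hT)).mono ?_
      have h0 : 0 ≤ (F' z).im := hT.1
      have h1 : (F' z).re ≤ (F' z).im := by
        refine le_of_mul_le_mul_right (hst.trans ?_) hsθ
        gcongr
      rw [hF're, hF'im] at h1
      rw [hF'im] at h0
      have h2 : dist y z ≤ 1.4143 * ((F z).im + ε) := by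
        refine abs_le_of_sq_le_sq' ?_ (by linarith) |>.2
        rw [norm']
        nlinarith
      have h3 := mul_le_mul_of_nonneg_left h2 hA.le
      have h4 := mul_nonneg hA.le h0
      have h5 := mul_nonneg hA.le (sub_nonneg.2 b4.le)
      linarith
    push Not at hsteep
    -- Without steep points, the nearest point of the trapezoid is on the critical arc of a smaller
    -- empty one; its edge costs at most `A · run + 4 A · rise`.
    by_cases hne : ∃ z ∈ P, InTrap θ r (F' z)
    · classical
      obtain ⟨z, hz, hmin⟩ := Finset.exists_min_image (P.filter fun z => InTrap θ r (F' z))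
        (fun z => dist y z) (by obtain ⟨z, hz, hT⟩ := hne; exact ⟨z, by simp [hz, hT]⟩)
      simp only [Finset.mem_filter] at hz hmin
      obtain ⟨hz, hT⟩ := hz
      obtain ⟨b1, b2, b3, b4, b5⟩ := below z hz hT
      have hdz : dist y z < r := by
        rw [← norm_frame heN.norm_eq_one y (!σ) z]; exact hT.2.2.1
      have hyz : y ≠ z := by rintro rfl; exact absurd b4 (lt_irrefl _)
      have hst := hsteep z hz hT
      refine (((hE y hy z hz (hdz.trans hL)).conn (by linarith [S.theta_gt]) heN hyz hT.1 hst.le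
        (Or.inl hst) ?_).trans (next z hz hT)).mono ?_
      · intro x hx hTx
        have hlt : dist y x < dist y z := by
          rw [← norm_frame heN.norm_eq_one y (!σ) x]; exact hTx.2.2.1
        refine absurd (hmin x ⟨hx, ?_⟩) (not_le.2 hlt)
        obtain ⟨t1, t2, t3, t4⟩ := (inTrap_iff dist_nonneg).1 hTx
        rw [← hF'] at t1 t2 t3 t4
        have hdpos : 0 < dist y z := dist_pos.2 hyz
        have hx0 : 0 < (F' x).re := by
          have : 0 < 2 * dist y z * (F' x).re := lt_of_le_of_lt (by positivity) t4
          exact pos_of_mul_pos_right this (by positivity)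
        refine (inTrap_iff hr0).2 ⟨t1, t2.trans_le (by gcongr), t3.trans_le (by gcongr), ?_⟩
        exact t4.trans_le (by gcongr)
      · rw [← hF', hF'im]
        have h0 : 0 ≤ (F' z).im := hT.1
        rw [hF'im] at h0
        have h1 : dist y z ≤ (s - (F z).re) + ((F z).im + ε) := by
          refine abs_le_of_sq_le_sq' ?_ (by linarith) |>.2
          rw [norm']
          nlinarith
        have h2 := mul_le_mul_of_nonneg_left
          (min_le_left ((F z).im + ε) (dist y z * Real.sin α)) hA.le
        have h3 := mul_le_mul_of_nonneg_left h1 hA.le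
        have h4 := mul_nonneg hA.le h0
        linarith
    · push Not at hne
      have e1 : (F' u).re = s := by rw [hF're, hFu]; simp
      have e2 : (F' u).im = ε := by rw [hF'im, hFu]; simp
      have hst : (F' u).im * Real.cos θ < (F' u).re * Real.sin θ := by
        rw [e1, e2]
        calc ε * Real.cos θ < s * Real.cos θ := by gcongr
          _ ≤ _ := by gcongr
      refine ((hE y hy u hu (by rwa [hyu])).conn (by linarith [S.theta_gt]) heN hyu'
        (by rw [← hF', e2]; linarith) hst.le (Or.inl hst) (by rw [hyu]; exact hne)).mono ?_
      rw [← hF', e2, hyu]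
      have h2 := mul_le_mul_of_nonneg_left (min_le_left ε (r * Real.sin α)) hA.le
      have h3 := mul_le_mul_of_nonneg_left hrs hA.le
      have h4 := mul_nonneg hA.le hε0
      linarith
  exact fun y hy => key _ y hy rfl

/-! ### Two points on the critical arc -/

theorem mul_cos_add_mul_sin_le {x y R : ℝ} (hR : 0 ≤ R) (h : x ^ 2 + y ^ 2 ≤ R ^ 2) (μ : ℝ) :
    x * Real.cos μ + y * Real.sin μ ≤ R := by
  refine abs_le_of_sq_le_sq' ?_ hR |>.2
  nlinarith [sq_nonneg (x * Real.sin μ - y * Real.cos μ), Real.sin_sq_add_cos_sq μ]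

/-- The trapezoid attached to the upper one of two points on the critical arc, and directed
to the lower one, is contained in the given trapezoid. -/
theorem trap_at_arc (S : Setting α θ A k N) {L φ φ' μ x y : ℝ} (hL : 0 < L) (h0 : 0 ≤ φ)
    (hle : φ ≤ φ') (hθ : φ' ≤ θ) (hα : φ' - φ ≤ α) (hor : φ' ≤ α ∨ α ≤ φ)
    (hμ : α ≤ (φ + φ') / 2 - μ) (hμ' : (φ + φ') / 2 - μ ≤ 2 * α) (hx : 0 < x) (hy : 0 < y)
    (hxy : x ^ 2 + y ^ 2 < (2 * L * Real.sin ((φ' - φ) / 2)) ^ 2) :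
    InTrap θ L ⟨L * Real.cos φ' + x * Real.sin μ - y * Real.cos μ,
      L * Real.sin φ' - x * Real.cos μ - y * Real.sin μ⟩ := by
  obtain ⟨γ, hγ⟩ : ∃ γ, γ = (φ' - φ) / 2 := ⟨_, rfl⟩
  rw [← hγ] at hxy
  have hα0 := S.pos
  have hα1 := S.le
  have hθ1 := S.theta_lt
  have hpi := Real.pi_gt_d4
  have hγ0 : 0 ≤ γ := by linarith
  have hγ1 : γ ≤ α / 2 := by linarith
  have hsγ : 0 ≤ Real.sin γ := Real.sin_nonneg_of_nonneg_of_le_pi hγ0 (by linarith)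
  have hsγ' : Real.sin γ ≤ α / 2 := (Real.sin_le hγ0).trans hγ1
  obtain ⟨R, hR⟩ : ∃ R, R = 2 * L * Real.sin γ := ⟨_, rfl⟩
  rw [← hR] at hxy
  have hR0 : 0 ≤ R := by rw [hR]; positivity
  have hRα : R ≤ L * α := by
    have := mul_le_mul_of_nonneg_left hsγ' hL.le
    rw [hR]; linarith
  have hxR : x ≤ R := abs_le_of_sq_le_sq' (by linarith [sq_nonneg y]) hR0 |>.2
  have hyR : y ≤ R := abs_le_of_sq_le_sq' (by linarith [sq_nonneg x]) hR0 |>.2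
  have hmono : Real.sin γ ≤ Real.sin (φ' - μ) :=
    Real.sin_le_sin_of_le_of_le_pi_div_two (by linarith) (by linarith) (by linarith)
  have hcos : 0.9 ≤ Real.cos (φ' - μ) := by
    have h1 := Real.one_sub_sq_div_two_le_cos (x := φ' - μ)
    have h2 : (φ' - μ) ^ 2 ≤ 0.2 ^ 2 := sq_le_sq' (by linarith) (by linarith)
    linarith
  have hcosφ' : 0.66585 ≤ Real.cos φ' := S.cos_theta_ge.trans
    (Real.cos_le_cos_of_nonneg_of_le_pi (by linarith) (by linarith) hθ)
  have hsinφ' : Real.sin φ' ≤ Real.sin θ :=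
    Real.sin_le_sin_of_le_of_le_pi_div_two (by linarith) (by linarith) hθ
  have hnorm : (L * Real.cos φ' + x * Real.sin μ - y * Real.cos μ) ^ 2
      + (L * Real.sin φ' - x * Real.cos μ - y * Real.sin μ) ^ 2 < L ^ 2 := by
    have e : (L * Real.cos φ' + x * Real.sin μ - y * Real.cos μ) ^ 2
        + (L * Real.sin φ' - x * Real.cos μ - y * Real.sin μ) ^ 2
        = L ^ 2 + x ^ 2 + y ^ 2
          - 2 * L * (x * Real.sin (φ' - μ) + y * Real.cos (φ' - μ)) := by
      rw [Real.sin_sub, Real.cos_sub]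
      linear_combination L ^ 2 * Real.sin_sq_add_cos_sq φ'
        + (x ^ 2 + y ^ 2) * Real.sin_sq_add_cos_sq μ
    rw [e]
    have h1 : x * x ≤ x * (2 * L * Real.sin (φ' - μ)) := by
      gcongr
      exact hxR.trans (by rw [hR]; gcongr)
    have h2 : y * y < y * (2 * L * Real.cos (φ' - μ)) := by
      gcongr
      have h3 : L * 0.9 ≤ L * Real.cos (φ' - μ) := by gcongr
      have h4 : L * α ≤ L * 0.0748 := by gcongr
      linarith
    linarith
  rw [inTrap_iff hL.le]
  dsimp only
  refine ⟨?_, ?_, hnorm, hnorm.trans ?_⟩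
  -- The small trapezoid must not cross the bottom side. For angles in the first cone the margin `α`
  -- gives `μ ≤ 0`, so that it leans away from the bottom; beyond that cone, `φ' ≥ 3γ` puts the arc
  -- point higher than the diameter `R`.
  · rcases hor with h | h
    · have h1 : Real.sin μ ≤ 0 :=
        Real.sin_nonpos_of_nonpos_of_neg_pi_le (by linarith) (by linarith)
      have h2 : Real.cos μ ≤ Real.cos γ := by
        rw [← Real.cos_neg μ]
        exact Real.cos_le_cos_of_nonneg_of_le_pi hγ0 (by linarith) (by linarith)
      have h3 : 0 ≤ Real.cos γ := Real.cos_nonneg_of_mem_Icc ⟨by linarith, by linarith⟩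
      have h4 : x * Real.cos μ ≤ R * Real.cos γ :=
        (mul_le_mul_of_nonneg_left h2 hx.le).trans (by gcongr)
      have h5 : R * Real.cos γ = L * Real.sin (2 * γ) := by rw [hR, Real.sin_two_mul]; ring
      have h6 : Real.sin (2 * γ) ≤ Real.sin φ' :=
        Real.sin_le_sin_of_le_of_le_pi_div_two (by linarith) (by linarith) (by linarith)
      have h7 : L * Real.sin (2 * γ) ≤ L * Real.sin φ' := by gcongr
      have h8 := mul_nonpos_of_nonneg_of_nonpos hy.le h1
      linarith
    · have h1 := mul_cos_add_mul_sin_le hR0 hxy.le μ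
      have h2 : Real.sin (3 * γ) ≤ Real.sin φ' :=
        Real.sin_le_sin_of_le_of_le_pi_div_two (by linarith) (by linarith) (by linarith)
      rw [Real.sin_three_mul] at h2
      have h4 : Real.sin γ ≤ 0.1 := by linarith
      have h3 : 2 * Real.sin γ ≤ Real.sin φ' := by
        have : Real.sin γ ^ 3 ≤ Real.sin γ * 0.1 ^ 2 := by
          rw [pow_succ']; gcongr
        linarith
      have h5 : R ≤ L * Real.sin φ' := by
        have := mul_le_mul_of_nonneg_left h3 hL.le
        rw [hR]; linarith
      linarith
  -- For `μ ≥ 0` the small trapezoid only descends from the arc point; for `μ < 0` the arc point is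
  -- itself far below the top side.
  · rcases le_or_gt 0 μ with h | h
    · have h1 : 0 ≤ Real.sin μ := Real.sin_nonneg_of_nonneg_of_le_pi h (by linarith)
      have h2 : 0 < Real.cos μ := Real.cos_pos_of_mem_Ioo ⟨by linarith, by linarith⟩
      have h3 : L * Real.sin φ' ≤ L * Real.sin θ := by gcongr
      have h4 : 0 < x * Real.cos μ := by positivity
      have h5 : 0 ≤ y * Real.sin μ := by positivity
      linarith
    · have h1 := mul_cos_add_mul_sin_le (x := -x) (y := -y) hR0 (by linarith [neg_sq x, neg_sq y]) μ
      have h2 : Real.sin φ' ≤ 0.2 := (Real.sin_le (by linarith)).trans (by linarith)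
      have h3 := mul_le_mul_of_nonneg_left (S.cos_theta_ge.trans S.cos_theta_le_sin_theta) hL.le
      have h4 := mul_le_mul_of_nonneg_left h2 hL.le
      have h5 : L * α ≤ L * 0.0748 := by gcongr
      linarith
  -- The abscissa stays above `0.55 L`, so the second disc condition follows from the first.
  · have h1 := mul_cos_add_mul_sin_le (x := y) (y := -x) hR0 (by linarith [neg_sq x]) μ
    have h2 : L * α ≤ L * 0.0748 := by gcongr
    have h3 : L * 0.66585 ≤ L * Real.cos φ' := by gcongr
    have h4 : 0.55 * L ≤ L * Real.cos φ' + x * Real.sin μ - y * Real.cos μ := by linarith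
    have h5 := mul_le_mul_of_nonneg_left h4 hL.le
    nlinarith only [h5, mul_pos hL hL]

/-- Two points on the critical arc of an empty trapezoid. -/
theorem conn_of_arc (S : Setting α θ A k N) {P : Finset ℂ} {G : SimpleGraph ℂ} {L : ℝ}
    (hE : ∀ p ∈ P, ∀ q ∈ P, dist p q < L → EdgeOK α θ A P G p q)
    {u e : ℂ} {σ : Bool} (he : IsDir α e) (hT : ∀ z ∈ P, ¬ InTrap θ L (frame u e σ z))
    {a b : ℂ} (ha : a ∈ P) (hb : b ∈ P) {φ φ' : ℝ} (hL : 0 < L)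
    (hFa : frame u e σ a = L * Complex.exp (φ * Complex.I))
    (hFb : frame u e σ b = L * Complex.exp (φ' * Complex.I))
    (h0 : 0 ≤ φ) (hle : φ ≤ φ') (hθ : φ' ≤ θ) (hα : φ' - φ ≤ α) (hor : φ' ≤ α ∨ α ≤ φ) :
    Conn G a b (A * (1 + 26.06 * α) * (L * (φ' - φ))) := by
  have hα0 := S.pos
  have hα1 := S.le
  have hA := S.A_pos
  have hpi := Real.pi_gt_d4
  obtain ⟨R, hR⟩ : ∃ R, R = 2 * L * Real.sin ((φ' - φ) / 2) := ⟨_, rfl⟩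
  have hR1 : R ≤ L * (φ' - φ) := by
    have := Real.sin_le (x := (φ' - φ) / 2) (by linarith)
    rw [hR]; nlinarith
  have hR0 : 0 ≤ R := by
    have := Real.sin_nonneg_of_nonneg_of_le_pi (x := (φ' - φ) / 2) (by linarith) (by linarith)
    rw [hR]; positivity
  -- The direction from `b` to `a` has polar angle `(φ + φ') / 2 - π / 2` in the frame of `u`.
  -- Taking the floor minus one leaves `a` below the new axis by an angle between `α` and `2α`; the
  -- upper bound produces `26.06 = 2 · 13.03`.
  obtain ⟨l, hl1, hl2⟩ : ∃ l : ℤ, α ≤ (φ + φ') / 2 - (l * α + Real.pi / 2) ∧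
      (φ + φ') / 2 - (l * α + Real.pi / 2) ≤ 2 * α := by
    refine ⟨⌊((φ + φ') / 2 - Real.pi / 2) / α⌋ - 1, ?_, ?_⟩
    · have := Int.floor_le (((φ + φ') / 2 - Real.pi / 2) / α)
      rw [le_div_iff₀ hα0] at this
      push_cast; linarith
    · have := Int.lt_floor_add_one (((φ + φ') / 2 - Real.pi / 2) / α)
      rw [div_lt_iff₀ hα0] at this
      push_cast; linarith
  obtain ⟨μ, hμ⟩ : ∃ μ, μ = l * α + Real.pi / 2 := ⟨_, rfl⟩
  rw [← hμ] at hl1 hl2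
  have hcb : Real.cos (l * α) = Real.sin μ := by rw [hμ, Real.sin_add_pi_div_two]
  have hsb : Real.sin (l * α) = -Real.cos μ := by rw [hμ, Real.cos_add_pi_div_two]; ring
  have heD := he.mul_spin σ l
  set e' := e * spin σ (l * α) with he'
  have hrot : ∀ z, frame b e' (!σ) z = conj ((frame u e σ z - frame u e σ b)
      * Complex.exp ((-(l * α) : ℝ) * Complex.I)) := by
    intro z
    rw [frame_not, he', frame_mul_spin, frame_sub u e σ b z]
  have hinv : ∀ z, (frame u e σ z).re = L * Real.cos φ' + (frame b e' (!σ) z).re * Real.sin μ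
        - (frame b e' (!σ) z).im * Real.cos μ ∧
      (frame u e σ z).im = L * Real.sin φ' - (frame b e' (!σ) z).re * Real.cos μ
        - (frame b e' (!σ) z).im * Real.sin μ := by
    intro z
    rw [hrot z, hFb]
    simp only [Complex.conj_re, Complex.conj_im, Complex.mul_re, Complex.mul_im, Complex.sub_re,
      Complex.sub_im, Complex.exp_ofReal_mul_I_re, Complex.exp_ofReal_mul_I_im, Complex.ofReal_re,
      Complex.ofReal_im, Real.cos_neg, Real.sin_neg, hcb, hsb]
    constructor
    · linear_combination (-(frame u e σ z).re + L * Real.cos φ') * Real.sin_sq_add_cos_sq μ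
    · linear_combination (-(frame u e σ z).im + L * Real.sin φ') * Real.sin_sq_add_cos_sq μ
  have hFa' : (frame b e' (!σ) a).re = R * Real.cos ((φ + φ') / 2 - μ) ∧
      (frame b e' (!σ) a).im = -(R * Real.sin ((φ + φ') / 2 - μ)) := by
    rw [hrot a, hFa, hFb]
    simp only [Complex.conj_re, Complex.conj_im, Complex.mul_re, Complex.mul_im, Complex.sub_re,
      Complex.sub_im, Complex.exp_ofReal_mul_I_re, Complex.exp_ofReal_mul_I_im, Complex.ofReal_re,
      Complex.ofReal_im, Real.cos_neg, Real.sin_neg, hcb, hsb]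
    have e1 := Real.cos_sub_cos φ φ'
    have e2 := Real.sin_sub_sin φ φ'
    have e3 : Real.sin ((φ - φ') / 2) = -Real.sin ((φ' - φ) / 2) := by
      rw [← Real.sin_neg]; congr 1; ring
    rw [e3] at e1 e2
    rw [hR, Real.cos_sub, Real.sin_sub]
    constructor
    · linear_combination L * Real.sin μ * e1 - L * Real.cos μ * e2
    · linear_combination -L * Real.cos μ * e1 - L * Real.sin μ * e2
  obtain ⟨hre, him⟩ := hFa'
  have hoff0 : 0 ≤ Real.sin ((φ + φ') / 2 - μ) :=
    Real.sin_nonneg_of_nonneg_of_le_pi (by linarith) (by linarith)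
  have hoff1 : Real.sin ((φ + φ') / 2 - μ) ≤ 2 * α := (Real.sin_le (by linarith)).trans hl2
  have hoffc := Real.cos_le_one ((φ + φ') / 2 - μ)
  have hoffc0 : 0 ≤ Real.cos ((φ + φ') / 2 - μ) :=
    Real.cos_nonneg_of_mem_Icc ⟨by linarith, by linarith⟩
  have hdist : dist b a = R := by
    rw [← norm_frame heD.norm_eq_one b (!σ) a]
    have := sq_norm_eq (frame b e' (!σ) a)
    rw [hre, him] at this
    refine (sq_eq_sq₀ (norm_nonneg _) hR0).1 ?_
    rw [this]
    linear_combination R ^ 2 * Real.sin_sq_add_cos_sq ((φ + φ') / 2 - μ)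
  have hRL : R < L := by nlinarith
  refine (conn_of_below S (R := R) (σ := !σ) hE hb heD ?_ a ha ?_ ?_ ?_ hdist.le (by rwa [hdist])).mono ?_
  · intro z hz hpos hz'
    obtain ⟨t1, t2, t3, t4⟩ := (inTrap_iff hR0).1 hz'
    have hx : 0 < (frame b e' (!σ) z).re := by
      have : 0 < 2 * R * (frame b e' (!σ) z).re := lt_of_le_of_lt (by positivity) t4
      exact pos_of_mul_pos_right this (by positivity)
    rw [hR] at t3
    refine hT z hz ?_
    have := trap_at_arc S hL h0 hle hθ hα hor hl1 hl2 hx hpos t3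
    rwa [← (hinv z).1, ← (hinv z).2] at this
  · rw [him]; nlinarith
  · rw [him, hre]; nlinarith
  · rw [hre]; nlinarith
  · rw [hre, him]
    have h1 : R * Real.cos ((φ + φ') / 2 - μ) ≤ R * 1 := by gcongr
    have h2 : R * Real.sin ((φ + φ') / 2 - μ) ≤ R * (2 * α) := by gcongr
    have h3 : A * (R * 1 + 13.03 * (R * (2 * α))) ≤ A * (1 + 26.06 * α) * (L * (φ' - φ)) := by
      have : A * (1 + 26.06 * α) * R ≤ A * (1 + 26.06 * α) * (L * (φ' - φ)) := by gcongr
      linarith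
    refine le_trans ?_ h3
    have h4 := mul_le_mul_of_nonneg_left h1 hA.le
    have h5 := mul_le_mul_of_nonneg_left h2 hA.le
    rw [neg_neg]
    linarith

/-! ### The induction step -/

theorem frame_polarPt (b : ℝ) (σ : Bool) (u : ℂ) (r ψ : ℝ) :
    frame u (Complex.exp (b * Complex.I)) σ (polarPt u r ψ)
      = polarPt 0 r (cond σ (b - ψ) (ψ - b)) := by
  cases σ
  · simp only [frame, polarPt, cond_false, ← Complex.exp_conj, add_sub_cancel_left, zero_add,
      mul_assoc, ← Complex.exp_add]
    congr 2; simp; ring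
  · simp only [frame, polarPt, cond_true, ← Complex.exp_conj, add_sub_cancel_left, zero_add,
      mul_assoc, ← Complex.exp_add, map_mul, Complex.conj_ofReal]
    congr 2; simp; ring

theorem polarPt_add_two_pi (u : ℂ) (r φ : ℝ) (l : ℤ) :
    polarPt u r (φ + l * (2 * Real.pi)) = polarPt u r φ := by
  unfold polarPt
  push_cast
  rw [add_mul, Complex.exp_add, mul_assoc, mul_assoc, ← mul_assoc (2 : ℂ),
    Complex.exp_int_mul_two_pi_mul_I, mul_one]

/-- The outcome of the two Yao steps in the coordinates of a frame. -/
theorem StepProp.in_frame (S : Setting α θ A k N) {P : Finset ℂ} {G : SimpleGraph ℂ}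
    (hstep : StepProp α P G) {u v e : ℂ} (hu : u ∈ P) (hv : v ∈ P) (he : IsDir α e) {σ : Bool}
    {L φ : ℝ} (hL : 0 < L) (hF : frame u e σ v = polarPt 0 L φ) (h0 : 0 ≤ φ) (h1 : φ ≤ θ)
    (h0' : 0 < φ ∨ σ = false) (h1' : φ < θ ∨ σ = true) :
    ∃ v' ∈ P, ∃ w ∈ P, ∃ φ' η r δ : ℝ, 0 ≤ φ' ∧ φ' ≤ θ ∧ 0 ≤ η ∧ η ≤ θ ∧ |φ - φ'| ≤ α ∧
      |η - φ'| ≤ α ∧ (φ ≤ α ∧ φ' ≤ α ∧ η ≤ α ∨ α ≤ φ ∧ α ≤ φ') ∧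
      frame u e σ v' = polarPt 0 r φ' ∧ frame w e σ v' = polarPt 0 δ η ∧
      0 < δ ∧ δ ≤ r ∧ r ≤ L ∧ Conn G w v' δ := by
  have hα := S.pos
  obtain ⟨b, rfl⟩ := he
  have huv : u ≠ v := by
    rintro rfl
    rw [frame_self, polarPt, zero_add] at hF
    have := congrArg (fun z : ℂ => ‖z‖) hF
    simp [Complex.norm_exp_ofReal_mul_I] at this
    linarith [abs_pos.2 hL.ne']
  obtain ⟨v', hv', w, hw, j, ψ, ψ', η, r, r', δ, hψ, hψ', hη, rfl, hp', hpw, hδ, hδr, hr, hc⟩ :=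
    hstep u hu v hv huv
  rw [frame_polarPt] at hF
  obtain ⟨hrL, l, hl⟩ := polar_unique hL (by linarith) hF.symm
  set χ : ℝ → ℝ := fun x => cond σ (b * α - x) (x - b * α) + l * (2 * Real.pi) with hχ
  have hpi : (l : ℝ) * (2 * Real.pi) = (2 * k * l : ℤ) * α := by
    rw [← S.k_mul]; push_cast; ring
  -- The integer `m` numbers the cone as seen in the frame. A reflection swaps the closed and the
  -- open end of a cone, hence the non-strict bounds; the conditions on `φ` at the ends of the arc
  -- exclude `m = -1` and `m = N`.
  obtain ⟨m, hm, hm1, hm2⟩ : ∃ m : ℤ, (∀ x, j * α ≤ x → x < (j + 1) * α →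
      m * α ≤ χ x ∧ χ x ≤ (m + 1) * α) ∧ 0 < (m + 1) * α ∧ m * α < N * α := by
    cases σ
    · simp only [hχ, cond_false] at hl ⊢
      rw [hpi] at hl ⊢
      refine ⟨j - b + 2 * k * l, fun x hx hx' => ⟨?_, ?_⟩, ?_, ?_⟩
      · push_cast; linarith
      · push_cast; linarith
      · push_cast at hl ⊢; linarith
      · have := h1'.resolve_right (by simp)
        rw [S.N_mul] at this
        push_cast at hl ⊢; linarith
    · simp only [hχ, cond_true] at hl ⊢
      rw [hpi] at hl ⊢
      refine ⟨b - j - 1 + 2 * k * l, fun x hx hx' => ⟨?_, ?_⟩, ?_, ?_⟩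
      · push_cast; linarith
      · push_cast; linarith
      · have := h0'.resolve_right (by simp)
        push_cast at hl ⊢; linarith
      · rw [S.N_mul] at h1
        push_cast at hl ⊢; linarith
  have hφ : φ = χ ψ := hl
  have hm1' : (0 : ℝ) ≤ m := by
    have : (0 : ℝ) < m + 1 := pos_of_mul_pos_left hm1 hα.le
    have h : (0 : ℤ) < m + 1 := by exact_mod_cast this
    exact_mod_cast (show (0 : ℤ) ≤ m by omega)
  have hm2' : (m : ℝ) + 1 ≤ N := by
    have : (m : ℝ) < N := lt_of_mul_lt_mul_right hm2 hα.le
    have h : m < (N : ℤ) := by exact_mod_cast this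
    exact_mod_cast (show m + 1 ≤ (N : ℤ) by omega)
  have hlow : 0 ≤ m * α := by positivity
  have hupp : (m + 1) * α ≤ θ := by rw [S.N_mul]; gcongr
  obtain ⟨a1, a2⟩ := hm ψ hψ.1 hψ.2
  obtain ⟨b1, b2⟩ := hm ψ' hψ'.1 hψ'.2
  obtain ⟨c1, c2⟩ := hm η hη.1 hη.2
  rw [← hφ] at a1 a2
  refine ⟨v', hv', w, hw, χ ψ', χ η, r', δ, by linarith, by linarith, by linarith, by linarith,
    abs_le.2 ⟨by linarith, by linarith⟩, abs_le.2 ⟨by linarith, by linarith⟩, ?_, ?_, ?_, hδ, hδr,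
    by linarith, hc⟩
  · rcases hm1'.eq_or_lt with h | h
    · rw [← h] at a2 b2 c2
      left
      exact ⟨by linarith, by linarith, by linarith⟩
    · right
      have h' : (0 : ℤ) < m := by exact_mod_cast h
      have h'' : (1 : ℝ) ≤ m := by exact_mod_cast (show (1 : ℤ) ≤ m by omega)
      have : 1 * α ≤ m * α := by gcongr
      exact ⟨by linarith, by linarith⟩
  · rw [hp', frame_polarPt, hχ, polarPt_add_two_pi]
  · rw [hpw, frame_polarPt, hχ, polarPt_add_two_pi]

theorem tie_factor_le (S : Setting α θ A k N) : 1 + 26.06 * α ≤ 2.95 := by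
  have := S.le
  linarith

/-- In the lowest cone the surcharge may vanish. The tie costs at most `2.95 (φ + φ')` times `A L`,
which `3 sin φ` and the height `13.03 sin φ'` of `v'` pay for. The terms in `δ` are absorbed because
`13.03 α + 0.0374 α ≤ 13.2 α`. -/
theorem budget_below_low (S : Setting α θ A k N) {L δ φ φ' η : ℝ} (hL : 0 < L)
    (hδ : 0 ≤ δ) (h0 : 0 ≤ φ) (h1 : φ ≤ α) (h0' : 0 ≤ φ') (h1' : φ' ≤ α)
    (h0'' : 0 ≤ η) (h1'' : η ≤ α) :
    A * (1 + 26.06 * α) * (L * |φ - φ'|) + (δ + (A * (L * Real.cos φ' - δ * Real.cos η)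
      + 13.03 * A * (-(L * Real.sin φ' - δ * Real.sin η)))) ≤ A * L + 3 * A * L * Real.sin φ := by
  have hα := S.pos
  have hα' := S.le
  have hA := S.A_pos
  have hc := tie_factor_le S
  have hsin : ∀ x, 0 ≤ x → x ≤ α → 0.999 * x ≤ Real.sin x := by
    intro x hx hx'
    rcases hx.eq_or_lt with rfl | hx0
    · simp
    have h := Real.sin_gt_sub_cube hx0
    have h2 : x ^ 3 ≤ 0.0748 ^ 2 * x := by
      have : x ^ 2 ≤ 0.0748 ^ 2 := by gcongr; linarith
      calc x ^ 3 = x ^ 2 * x := by ring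
        _ ≤ _ := by gcongr
    linarith
  have s1 := hsin φ h0 h1
  have s2 := hsin φ' h0' h1'
  have hAL : 0 < A * L := by positivity
  have e1 : (1 + 26.06 * α) * |φ - φ'| ≤ 3 * Real.sin φ + 13.03 * Real.sin φ' := by
    have : |φ - φ'| ≤ φ + φ' := abs_le.2 ⟨by linarith, by linarith⟩
    calc _ ≤ 2.95 * (φ + φ') := by gcongr
      _ ≤ _ := by linarith
  have e2 := mul_le_mul_of_nonneg_left e1 hAL.le
  have e3 : 1 + 13.03 * A * Real.sin η - A * Real.cos η ≤ 0 := by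
    have t1 : Real.sin η ≤ α := (Real.sin_le h0'').trans h1''
    have t2 : 1 - 0.0374 * α ≤ Real.cos η := by
      have := Real.one_sub_sq_div_two_le_cos (x := η)
      have : η ^ 2 ≤ α * 0.0748 := by
        rw [sq]; gcongr; linarith
      linarith
    have t3 := mul_le_mul_of_nonneg_left t1 hA.le
    have t4 := mul_le_mul_of_nonneg_left t2 hA.le
    have t5 := S.one_le
    have t6 : 0 < A * α := by positivity
    linarith
  have e4 := mul_nonpos_of_nonneg_of_nonpos hδ e3
  have e5 := mul_le_mul_of_nonneg_left (Real.cos_le_one φ') hAL.le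
  linarith

/-- The surcharge `3 sin α` pays for the tie. The directions `φ'` and `η` differ by a chord of
length at most `α`, so by Cauchy-Schwarz the loss per unit of `δ` is at most `√(1 + 13.03²) A α ≤
13.2 A α`. -/
theorem budget_below_high (S : Setting α θ A k N) {L δ φ φ' η : ℝ} (hL : 0 < L)
    (hδ : 0 ≤ δ) (hδL : δ ≤ L) (h0' : 0 ≤ φ') (h1' : φ' ≤ θ) (hφ : |φ - φ'| ≤ α)
    (hη : |η - φ'| ≤ α) :
    A * (1 + 26.06 * α) * (L * |φ - φ'|) + (δ + (A * (L * Real.cos φ' - δ * Real.cos η)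
      + 13.03 * A * (-(L * Real.sin φ' - δ * Real.sin η)))) ≤ A * L + 3 * A * L * Real.sin α := by
  have hα := S.pos
  have hα' := S.le
  have hA := S.A_pos
  have hc := tie_factor_le S
  have hAL : 0 < A * L := by positivity
  have e1 : (1 + 26.06 * α) * |φ - φ'| ≤ 3 * Real.sin α := by
    have := S.sin_alpha_ge
    calc _ ≤ 2.95 * α := by gcongr
      _ ≤ _ := by linarith
  have e2 := mul_le_mul_of_nonneg_left e1 hAL.le
  have hc1 : (Real.cos φ' - Real.cos η) ^ 2 + (Real.sin η - Real.sin φ') ^ 2 ≤ α ^ 2 := by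
    have h1 : (Real.cos φ' - Real.cos η) ^ 2 + (Real.sin η - Real.sin φ') ^ 2
        = 2 - 2 * Real.cos (η - φ') := by
      rw [Real.cos_sub]
      linear_combination Real.sin_sq_add_cos_sq φ' + Real.sin_sq_add_cos_sq η
    have h2 := Real.one_sub_sq_div_two_le_cos (x := η - φ')
    have h3 : (η - φ') ^ 2 ≤ α ^ 2 := by rw [← sq_abs]; gcongr
    linarith
  have e3 : (Real.cos φ' - Real.cos η) + 13.03 * (Real.sin η - Real.sin φ') ≤ 13.2 * α := by
    refine abs_le_of_sq_le_sq' ?_ (by linarith) |>.2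
    nlinarith only [hc1, sq_nonneg (13.03 * (Real.cos φ' - Real.cos η)
      - (Real.sin η - Real.sin φ')), sq_nonneg α]
  have e4 := mul_le_mul_of_nonneg_left e3 hA.le
  have e5 : 1 + A * (Real.cos φ' - Real.cos η - 1) + 13.03 * A * (Real.sin η - Real.sin φ') ≤ 0 := by
    have := S.one_le
    linarith
  have e6 := mul_nonpos_of_nonneg_of_nonpos hδ e5
  have hsφ : 0 ≤ Real.sin φ' := Real.sin_nonneg_of_nonneg_of_le_pi h0'
    (by linarith [S.theta_lt_pi_div_two, Real.pi_pos])
  have e7 : 0 ≤ A * ((L - δ) * (1 - Real.cos φ')) :=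
    mul_nonneg hA.le (mul_nonneg (by linarith) (by linarith [Real.cos_le_one φ']))
  have e8 : 0 ≤ A * ((L - δ) * Real.sin φ') := mul_nonneg hA.le (mul_nonneg (by linarith) hsφ)
  linarith

/-- A quadratic estimate behind `norm_le_of_left`. -/
theorem le_of_quadratic {L T c s p q p₀ : ℝ} (hL : 0 < L) (hs : 0 ≤ s)
    (hp : p ≤ L) (hq : 0 ≤ q) (hqT : q ≤ T * (L - p)) (hc : 1 < 2 * c)
    (h : 2 * L * (p * c - q * s) ≤ p ^ 2 + q ^ 2)
    (h₀ : p₀ ^ 2 + T ^ 2 * (1 - p₀) ^ 2 - 2 * p₀ * c + 2 * T * s * (1 - p₀) < 0) :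
    p ≤ p₀ * L := by
  by_contra hlt
  push Not at hlt
  have h1 : 0 ≤ p ^ 2 + T ^ 2 * (L - p) ^ 2 - 2 * L * p * c + 2 * L * T * s * (L - p) := by
    have h2 : q ^ 2 ≤ (T * (L - p)) ^ 2 := by gcongr
    have h3 : L * s * q ≤ L * s * (T * (L - p)) := by gcongr
    nlinarith only [h, h2, h3]
  -- The quadratic in `p` is convex and negative at `p₀ L` (by `h₀`) and at `L` (as `1 < 2c`), hence
  -- negative in between, against `h1`. The identity is the interpolation between these two values.
  have e : (p ^ 2 + T ^ 2 * (L - p) ^ 2 - 2 * L * p * c + 2 * L * T * s * (L - p)) * (L - p₀ * L)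
      = (L - p) * L ^ 2
          * (p₀ ^ 2 + T ^ 2 * (1 - p₀) ^ 2 - 2 * p₀ * c + 2 * T * s * (1 - p₀))
        + (p - p₀ * L) * L ^ 2 * (1 - 2 * c)
        - (1 + T ^ 2) * ((L - p) * (p - p₀ * L) * (L - p₀ * L)) := by ring
  have hLp : 0 < L - p₀ * L := by linarith
  have g1 := mul_nonneg h1 hLp.le
  have g2 : (L - p) * L ^ 2
      * (p₀ ^ 2 + T ^ 2 * (1 - p₀) ^ 2 - 2 * p₀ * c + 2 * T * s * (1 - p₀)) ≤ 0 :=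
    mul_nonpos_of_nonneg_of_nonpos (mul_nonneg (by linarith) (by positivity)) h₀.le
  have g3 : (p - p₀ * L) * L ^ 2 * (1 - 2 * c) < 0 :=
    mul_neg_of_pos_of_neg (mul_pos (by linarith) (by positivity)) (by linarith)
  have g4 : 0 ≤ (1 + T ^ 2) * ((L - p) * (p - p₀ * L) * (L - p₀ * L)) :=
    mul_nonneg (by positivity) (mul_nonneg (mul_nonneg (by linarith) (by linarith)) hLp.le)
  linarith

/-- A point to the left of the trapezoid, in the cone of a point on the critical arc, is close to
the origin. -/
theorem norm_le_of_left (S : Setting α θ A k N) {L δ φ η c s κ κ' : ℝ} (hL : 0 < L) (hδ : 0 ≤ δ)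
    (hδL : δ ≤ L) (hη : |η - φ| ≤ α) (hc : c ≤ Real.cos φ) (hs : Real.sin φ ≤ s)
    (hφ : 0 ≤ Real.sin φ)
    (hout : 2 * L * (L * Real.cos φ - δ * Real.cos η)
      ≤ (L * Real.cos φ - δ * Real.cos η) ^ 2 + (L * Real.sin φ - δ * Real.sin η) ^ 2)
    (hc1 : 1 < 2 * c) (hκ : 0 ≤ κ) (hκ2 : κ ≤ 2)
    (h₀ : κ ^ 2 * α + 1.0063 * α - 2 * κ * c + 2.0062 * s * (1 - κ * α) < 0)
    (h₁ : κ ^ 2 + 1.0063 ≤ κ' ^ 2) :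
    (L * Real.cos φ - δ * Real.cos η) ^ 2 + (L * Real.sin φ - δ * Real.sin η) ^ 2
      ≤ (κ' * α * L) ^ 2 := by
  have hα := S.pos
  have hα' := S.le
  obtain ⟨a, ha⟩ : ∃ a, a = η - φ := ⟨_, rfl⟩
  have hη' : η = φ + a := by rw [ha]; ring
  rw [← ha] at hη
  subst hη'
  -- Here `p` is the component of the point along the direction `φ`, and `q` the size of the
  -- perpendicular one; `1.0031 α` bounds the tangent of the angle `a`.
  obtain ⟨p, hp⟩ : ∃ p, p = L - δ * Real.cos a := ⟨_, rfl⟩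
  obtain ⟨q, hq⟩ : ∃ q, q = δ * |Real.sin a| := ⟨_, rfl⟩
  have hcos : 0.997 ≤ Real.cos a := by
    have h1 := Real.one_sub_sq_div_two_le_cos (x := a)
    have h2 : a ^ 2 ≤ 0.0748 ^ 2 := by rw [← sq_abs]; gcongr; linarith
    linarith
  have hcos1 := Real.cos_le_one a
  have hsina : |Real.sin a| ≤ α := Real.abs_sin_le_abs.trans hη
  have hq0 : 0 ≤ q := by rw [hq]; positivity
  have hqT : q ≤ 1.0031 * α * (L - p) := by
    rw [hq, hp]
    have h1 : |Real.sin a| ≤ 1.0031 * α * Real.cos a := by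
      have : 1.0031 * α * 0.997 ≤ 1.0031 * α * Real.cos a := by gcongr
      linarith
    have := mul_le_mul_of_nonneg_left h1 hδ
    linarith
  have hp0 : 0 ≤ p := by
    have : δ * Real.cos a ≤ δ * 1 := by gcongr
    rw [hp]; linarith
  have hpL : p ≤ L := by
    have : 0 ≤ δ * Real.cos a := mul_nonneg hδ (by linarith)
    rw [hp]; linarith
  have hX : L * Real.cos φ - δ * Real.cos (φ + a) = p * Real.cos φ + δ * Real.sin a * Real.sin φ := by
    rw [hp, Real.cos_add]; ring
  have hN : (L * Real.cos φ - δ * Real.cos (φ + a)) ^ 2 + (L * Real.sin φ - δ * Real.sin (φ + a)) ^ 2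
      = p ^ 2 + q ^ 2 := by
    have : q ^ 2 = δ ^ 2 * Real.sin a ^ 2 := by rw [hq, mul_pow, sq_abs]
    rw [this, hp, Real.cos_add, Real.sin_add]
    linear_combination (L ^ 2 - 2 * L * δ * Real.cos a + δ ^ 2 * (Real.cos a ^ 2 + Real.sin a ^ 2))
      * Real.sin_sq_add_cos_sq φ
  rw [hN] at hout ⊢
  rw [hX] at hout
  have hX' : p * c - q * s ≤ p * Real.cos φ + δ * Real.sin a * Real.sin φ := by
    have h1 : p * c ≤ p * Real.cos φ := by gcongr
    have h2 : q * Real.sin φ ≤ q * s := by gcongr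
    have h3 : -(q * Real.sin φ) ≤ δ * Real.sin a * Real.sin φ := by
      have := mul_le_mul_of_nonneg_left (neg_abs_le (Real.sin a)) (mul_nonneg hδ hφ)
      rw [hq]; linarith
    linarith
  have hκα : κ * α < 1 := by nlinarith
  have key : p ≤ κ * α * L := by
    refine le_of_quadratic (T := 1.0031 * α) (c := c) (s := s) hL (hφ.trans hs) hpL hq0 hqT hc1
      ?_ ?_
    · exact (mul_le_mul_of_nonneg_left hX' (by positivity)).trans hout
    · have h1 : (1 - κ * α) ^ 2 ≤ 1 := by
        have : 0 ≤ κ * α := by positivity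
        nlinarith
      have h2 : (1.0031 * α) ^ 2 * (1 - κ * α) ^ 2 ≤ (1.0031 * α) ^ 2 * 1 := by gcongr
      have h4 := mul_neg_of_pos_of_neg hα h₀
      nlinarith only [h2, h4, sq_nonneg α]
  have h1 : p ^ 2 ≤ (κ * α * L) ^ 2 := by gcongr
  have h2 : q ^ 2 ≤ (1.0031 * α * L) ^ 2 := by
    gcongr
    refine hqT.trans ?_
    gcongr
    linarith
  have h3 : 0 ≤ (α * L) ^ 2 := by positivity
  have h4 := mul_le_mul_of_nonneg_right h₁ h3
  nlinarith only [h1, h2, h3, h4]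

theorem polarPt_zero_re (r φ : ℝ) : (polarPt 0 r φ).re = r * Real.cos φ := by
  simp [polarPt, Complex.exp_ofReal_mul_I_re, Complex.exp_ofReal_mul_I_im]

theorem polarPt_zero_im (r φ : ℝ) : (polarPt 0 r φ).im = r * Real.sin φ := by
  simp [polarPt, Complex.exp_ofReal_mul_I_re, Complex.exp_ofReal_mul_I_im]

/-- The induction step for an edge whose cone at `u` lies in the sector of the trapezoid. -/
theorem conn_of_edge (S : Setting α θ A k N) {P : Finset ℂ} {G : SimpleGraph ℂ}
    (hstep : StepProp α P G) {L : ℝ} (hL : 0 < L)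
    (hE : ∀ p ∈ P, ∀ q ∈ P, dist p q < L → EdgeOK α θ A P G p q)
    {u v e : ℂ} (hu : u ∈ P) (hv : v ∈ P) (he : IsDir α e) {σ : Bool} {φ : ℝ}
    (hF : frame u e σ v = polarPt 0 L φ) (h0 : 0 ≤ φ) (h1 : φ ≤ θ)
    (h0' : 0 < φ ∨ σ = false) (h1' : φ < θ ∨ σ = true)
    (hT : ∀ z ∈ P, ¬ InTrap θ L (frame u e σ z)) :
    Conn G u v (A * L + 3 * A * L * min (Real.sin φ) (Real.sin α)) := by
  have hα := S.pos
  have hα' := S.le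
  have hA := S.A_pos
  have hpi := Real.pi_gt_d4
  have hθlt := S.theta_lt
  have hsθ := S.sin_theta_pos
  have hen := he.norm_eq_one
  obtain ⟨v', hv', w, hw, φ', η, r, δ, a0, a1, b0, b1, hφφ', hηφ', hor, hFv', hFw, hδ, hδr, hrL, hwv'⟩ :=
    hstep.in_frame S hu hv he hL hF h0 h1 h0' h1'
  have hcosφ' : 0.66585 ≤ Real.cos φ' := S.cos_theta_ge.trans
    (Real.cos_le_cos_of_nonneg_of_le_pi (by linarith) (by linarith) a1)
  have hsinφ' : Real.sin φ' ≤ Real.sin θ :=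
    Real.sin_le_sin_of_le_of_le_pi_div_two (by linarith) (by linarith) a1
  have hsinφ'0 : 0 ≤ Real.sin φ' := Real.sin_nonneg_of_nonneg_of_le_pi a0 (by linarith)
  -- If `v'` were nearer than `v`, it would lie in the empty trapezoid; so it is on the critical arc
  -- as well.
  obtain rfl : r = L := by
    refine hrL.eq_or_lt.resolve_right fun hlt => hT v' hv' ?_
    have hr0 : 0 < r := by linarith
    rw [hFv', inTrap_iff hL.le, polarPt_zero_re, polarPt_zero_im]
    have e1 : (r * Real.cos φ') ^ 2 + (r * Real.sin φ') ^ 2 = r ^ 2 := by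
      linear_combination r ^ 2 * Real.sin_sq_add_cos_sq φ'
    rw [e1]
    refine ⟨by positivity, ?_, by gcongr, ?_⟩
    · calc r * Real.sin φ' ≤ r * Real.sin θ := by gcongr
        _ < _ := by gcongr
    · have : r * r < r * L := by gcongr
      have : r * L * 0.66585 ≤ r * L * Real.cos φ' := by gcongr
      nlinarith only [this, hr0, hL, mul_pos hr0 hL, hlt]
  have tie : Conn G v v' (A * (1 + 26.06 * α) * (r * |φ - φ'|)) := by
    rw [polarPt, zero_add] at hF hFv'
    have hab := abs_le.1 hφφ'
    rcases le_total φ φ' with h | h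
    · rw [abs_of_nonpos (by linarith), neg_sub]
      exact conn_of_arc S hE he hT hv hv' hL hF hFv' h0 h a1 (by linarith)
        (hor.imp (fun h => h.2.1) (fun h => h.1))
    · rw [abs_of_nonneg (by linarith)]
      exact (conn_of_arc S hE he hT hv' hv hL hFv' hF a0 h h1 (by linarith)
        (hor.imp (fun h => h.1) (fun h => h.2))).symm
  have hFw' : frame u e σ w = polarPt 0 r φ' - polarPt 0 δ η := by
    rw [← hFw, frame_sub u e σ w v', hFv']; ring
  have hwre : (frame u e σ w).re = r * Real.cos φ' - δ * Real.cos η := by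
    rw [hFw', Complex.sub_re, polarPt_zero_re, polarPt_zero_re]
  have hwim : (frame u e σ w).im = r * Real.sin φ' - δ * Real.sin η := by
    rw [hFw', Complex.sub_im, polarPt_zero_im, polarPt_zero_im]
  have hwn : (r * Real.cos φ' - δ * Real.cos η) ^ 2 + (r * Real.sin φ' - δ * Real.sin η) ^ 2
      = dist u w ^ 2 := by
    rw [← norm_frame hen u σ w, sq_norm_eq, hwre, hwim]
  have hwL : dist u w < r := by
    refine lt_of_pow_lt_pow_left₀ 2 hL.le ?_
    rw [← hwn]
    have e1 : (r * Real.cos φ' - δ * Real.cos η) ^ 2 + (r * Real.sin φ' - δ * Real.sin η) ^ 2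
        = r ^ 2 + δ ^ 2 - 2 * r * δ * Real.cos (η - φ') := by
      rw [Real.cos_sub]
      linear_combination r ^ 2 * Real.sin_sq_add_cos_sq φ' + δ ^ 2 * Real.sin_sq_add_cos_sq η
    rw [e1]
    have h2 := Real.one_sub_sq_div_two_le_cos (x := η - φ')
    have h3 : (η - φ') ^ 2 ≤ 0.0748 ^ 2 := by
      rw [← sq_abs]; gcongr; linarith
    have h4 : δ * δ ≤ δ * r := by gcongr
    have h5 : r * δ * 0.9 ≤ r * δ * Real.cos (η - φ') := by gcongr; linarith
    nlinarith only [h4, h5, mul_pos hL hδ]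
  have hminφ : φ ≤ α → min (Real.sin φ) (Real.sin α) = Real.sin φ := fun h =>
    min_eq_left (Real.sin_le_sin_of_le_of_le_pi_div_two (by linarith) (by linarith) h)
  have hminα : α ≤ φ → min (Real.sin φ) (Real.sin α) = Real.sin α := fun h =>
    min_eq_right (Real.sin_le_sin_of_le_of_le_pi_div_two (by linarith) (by linarith) h)
  have hc := tie_factor_le S
  rcases lt_or_ge (r * Real.sin φ' - δ * Real.sin η) 0 with hneg | hnonneg
  · have hφη : φ' ≤ η := by
      by_contra h
      push Not at h
      have : Real.sin η ≤ Real.sin φ' :=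
        Real.sin_le_sin_of_le_of_le_pi_div_two (by linarith) (by linarith) h.le
      have : 0 ≤ Real.sin η := Real.sin_nonneg_of_nonneg_of_le_pi b0 (by linarith)
      have : δ * Real.sin η ≤ r * Real.sin φ' := by gcongr
      linarith
    have hcosη : Real.cos η ≤ Real.cos φ' :=
      Real.cos_le_cos_of_nonneg_of_le_pi a0 (by linarith) hφη
    have hcosη0 : 0 ≤ Real.cos η := Real.cos_nonneg_of_mem_Icc ⟨by linarith, by linarith⟩
    have hre0 : 0 ≤ r * Real.cos φ' - δ * Real.cos η := by
      have : δ * Real.cos η ≤ r * Real.cos φ' := by gcongr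
      linarith
    have hre1 : r * Real.cos φ' - δ * Real.cos η ≤ r := by
      have h2 : r * Real.cos φ' ≤ r * 1 := by gcongr; exact Real.cos_le_one _
      have h3 : 0 ≤ δ * Real.cos η := by positivity
      linarith
    have chain := conn_of_below S (R := r) hE hu he (fun z hz _ => hT z hz) w hw
      (by rw [hwim]; exact hneg.le) (by rw [hwim, hwre]; linarith) (by rwa [hwre]) hwL.le hwL
    rw [hwre, hwim] at chain
    refine (tie.trans (hwv'.symm.trans chain)).symm.mono ?_
    rcases hor with ⟨c1, c2, c3⟩ | ⟨c1, c2⟩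
    · rw [hminφ c1]
      exact budget_below_low S hL hδ.le h0 c1 a0 c2 b0 c3
    · rw [hminα c1]
      exact budget_below_high S hL hδ.le hδr a0 a1 hφφ' hηφ'
  · have hout : 2 * r * (r * Real.cos φ' - δ * Real.cos η)
        ≤ (r * Real.cos φ' - δ * Real.cos η) ^ 2 + (r * Real.sin φ' - δ * Real.sin η) ^ 2 := by
      by_contra h
      push Not at h
      refine hT w hw ?_
      rw [inTrap_iff hL.le, hwre, hwim]
      refine ⟨hnonneg, ?_, ?_, h⟩
      · rcases b0.eq_or_lt with h' | h'
        · have h2 := abs_le.1 hηφ'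
          have h3 : Real.sin φ' ≤ φ' := Real.sin_le a0
          have h4 := S.cos_theta_ge.trans S.cos_theta_le_sin_theta
          have h5 : r * Real.sin φ' < r * Real.sin θ := by gcongr; linarith
          rw [← h', Real.sin_zero]
          linarith
        · have h2 : 0 < Real.sin η := Real.sin_pos_of_pos_of_lt_pi h' (by linarith)
          have h3 : r * Real.sin φ' ≤ r * Real.sin θ := by gcongr
          have h4 : 0 < δ * Real.sin η := by positivity
          linarith
      · rw [hwn]; gcongr
    have hspan := (conn_of_dist_lt S hE u hu w hw hwL)
    refine ((hspan.trans hwv').trans tie.symm).mono ?_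
    have hAr : 0 < A * r := by positivity
    have hone := mul_le_mul_of_nonneg_left S.one_le hL.le
    rcases hor with ⟨c1, c2, c3⟩ | ⟨c1, c2⟩
    · have hcα : Real.cos α ≤ Real.cos φ' :=
        Real.cos_le_cos_of_nonneg_of_le_pi a0 (by linarith) c2
      -- Nearly horizontal directions allow a small `κ`. The surcharge is not used: `8.5 · 1.1 +
      -- 2.95 < 13.2`.
      have h2 := norm_le_of_left S (c := 0.997) (s := 0.0748) (κ := 0.2) (κ' := 1.1) hL hδ.le hδr hηφ'
        (S.cos_alpha_ge.trans hcα) ((Real.sin_le a0).trans (by linarith)) hsinφ'0 hout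
        (by norm_num) (by norm_num) (by norm_num) (by linarith) (by norm_num)
      rw [hwn] at h2
      have h3 : dist u w ≤ 1.1 * α * r := abs_le_of_sq_le_sq' h2 (by positivity) |>.2
      have h4 := mul_le_mul_of_nonneg_left h3 hA.le
      have h5 : (1 + 26.06 * α) * |φ - φ'| ≤ 2.95 * α := by gcongr
      have h6 := mul_le_mul_of_nonneg_left h5 hAr.le
      have h7 : 0 ≤ A * r * min (Real.sin φ) (Real.sin α) := by
        rw [hminφ c1]
        exact mul_nonneg hAr.le (Real.sin_nonneg_of_nonneg_of_le_pi h0 (by linarith))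
      have h8 := mul_pos hAr hα
      linarith
    -- The value `κ = 1.18` makes the quadratic negative up to `α = 0.0748`. Then `8.5 · 1.55 <
    -- 13.2`, and the surcharge covers the tie since `2.95 < 3 · 0.999`.
    · have h2 := norm_le_of_left S (c := 0.66585) (s := 0.7468) (κ := 1.18) (κ' := 1.55) hL hδ.le hδr
        hηφ' hcosφ' (hsinφ'.trans S.sin_theta_le) hsinφ'0 hout
        (by norm_num) (by norm_num) (by norm_num) (by linarith) (by norm_num)
      rw [hwn] at h2
      have h3 : dist u w ≤ 1.55 * α * r := abs_le_of_sq_le_sq' h2 (by positivity) |>.2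
      have h4 := mul_le_mul_of_nonneg_left h3 hA.le
      have h5 : (1 + 26.06 * α) * |φ - φ'| ≤ 2.95 * α := by gcongr
      have h6 := mul_le_mul_of_nonneg_left h5 hAr.le
      have h7 := mul_le_mul_of_nonneg_left S.sin_alpha_ge hAr.le
      rw [hminα c1]
      have h8 := mul_pos hAr hα
      linarith

/-- The mirror image of a trapezoid under exchange of the endpoints of its bottom side. -/
theorem inTrap_mirror {L : ℝ} {ζ : ℂ} : InTrap θ L (-conj (ζ - L)) ↔ InTrap θ L ζ := by
  have e1 : ‖-conj (ζ - L)‖ = ‖ζ - L‖ := by rw [norm_neg, RCLike.norm_conj]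
  have e2 : ‖-conj (ζ - L) - L‖ = ‖ζ‖ := by
    have : -conj (ζ - L) - L = -conj ζ := by simp
    rw [this, norm_neg, RCLike.norm_conj]
  rw [InTrap, InTrap, e1, e2]
  have e3 : (-conj (ζ - L)).im = ζ.im := by simp
  rw [e3]
  tauto

theorem edgeOK (S : Setting α θ A k N) {P : Finset ℂ} {G : SimpleGraph ℂ}
    (hstep : StepProp α P G) : ∀ u ∈ P, ∀ v ∈ P, EdgeOK α θ A P G u v := by
  refine dist_induction P _ fun u hu v hv ih e σ φ he h0 h1 h1' hF hT => ?_
  rcases eq_or_ne u v with rfl | huv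
  · exact Conn.refl _ (by simp)
  have hL : 0 < dist u v := dist_pos.2 huv
  have hF' : frame u e σ v = polarPt 0 (dist u v) φ := by rw [hF, polarPt, zero_add]
  -- In a reversed frame the half-open cone containing the ray of angle `0` lies outside the sector,
  -- so the Yao step at `u` gives no control. The trapezoid is symmetric under exchange of the ends
  -- of its bottom side, so the step is done at `v` instead, in a positively oriented frame.
  by_cases h : 0 < φ ∨ σ = false
  · exact conn_of_edge S hstep hL ih hu hv he hF' h0 h1 h h1' hT
  push Not at h
  obtain ⟨hφ, hσ⟩ := h
  obtain rfl : φ = 0 := le_antisymm hφ h0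
  obtain rfl : σ = true := by simpa using hσ
  have hFv : frame u e true v = dist u v := by rw [hF]; simp
  have hflip : ∀ z, frame v (-e) false z = -conj (frame u e true z - dist u v) := by
    intro z
    rw [← Bool.not_true, frame_flip u e true v z, hFv]
  refine (conn_of_edge S hstep hL ih hv hu (he.neg S) (σ := false) (φ := 0) ?_ le_rfl h1 (Or.inr rfl)
    (Or.inl (by linarith [S.theta_gt])) ?_).symm
  · rw [hflip, frame_self, polarPt]; simp
  · intro z hz
    rw [hflip, inTrap_mirror]
    exact hT z hz

/-! ### Edges of the trapezoidal Yao graph -/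

open Filter Topology

/-- Complex conjugation if `σ = true`. -/
def conjIf (σ : Bool) (ζ : ℂ) : ℂ := cond σ (conj ζ) ζ

theorem continuous_conjIf (σ : Bool) : Continuous (conjIf σ) := by
  cases σ
  · exact continuous_id
  · exact Complex.continuous_conj

theorem frame_add_mul {e : ℂ} (he : ‖e‖ = 1) (u : ℂ) (σ : Bool) (r : ℝ) (ζ : ℂ) :
    frame u e σ (u + r * (e * conjIf σ ζ)) = r * ζ := by
  have h : e * conj e = 1 := by rw [Complex.mul_conj, Complex.normSq_eq_norm_sq, he]; simp
  cases σ
  · simp only [frame, conjIf, cond_false, add_sub_cancel_left]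
    linear_combination (r * ζ) * h
  · simp only [frame, conjIf, cond_true, add_sub_cancel_left, map_mul, Complex.conj_conj,
      Complex.conj_ofReal]
    linear_combination (r * ζ) * h

theorem exists_lt_inTrap {L : ℝ} {ζ : ℂ} (hL : 0 < L) (h : InTrap θ L ζ) :
    ∃ μ, 0 < μ ∧ μ < L ∧ InTrap θ μ ζ := by
  obtain ⟨h1, h2, h3, h4⟩ := h
  have c1 : ∀ᶠ μ in 𝓝[<] L, ζ.im < μ * Real.sin θ :=
    ((continuous_id.mul continuous_const).tendsto L |>.eventually_const_lt h2).filter_mono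
      nhdsWithin_le_nhds
  have c2 : ∀ᶠ μ in 𝓝[<] L, ‖ζ‖ < μ :=
    (continuous_id.tendsto L |>.eventually_const_lt h3).filter_mono nhdsWithin_le_nhds
  have c3 : ∀ᶠ μ : ℝ in 𝓝[<] L, ‖ζ - μ‖ < μ := by
    have hc : Continuous fun μ : ℝ => μ - ‖ζ - μ‖ := by fun_prop
    have := (hc.tendsto L).eventually_const_lt (sub_pos.2 h4)
    filter_upwards [this.filter_mono nhdsWithin_le_nhds] with μ hμ using sub_pos.1 hμ
  have c4 : ∀ᶠ μ in 𝓝[<] L, 0 < μ :=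
    (continuous_id.tendsto L |>.eventually_const_lt hL).filter_mono nhdsWithin_le_nhds
  obtain ⟨μ, a1, a2, a3, a4, a5⟩ :=
    (c1.and (c2.and (c3.and (c4.and self_mem_nhdsWithin)))).exists
  exact ⟨μ, a4, a5, h1, a1, a2, a3⟩

theorem mem_trapezoid_of_inTrap {μ : ℝ} {ξ : ℂ} (hμ : 0 < μ) (h : InTrap θ μ ξ) (h0 : 0 < ξ.im) :
    ((μ⁻¹ : ℝ) : ℂ) * ξ ∈ trapezoid θ := by
  obtain ⟨-, h2, h3, h4⟩ := h
  have hi : 0 < μ⁻¹ := inv_pos.2 hμ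
  have e1 : ‖((μ⁻¹ : ℝ) : ℂ) * ξ‖ < 1 := by
    rw [norm_mul, Complex.norm_real, Real.norm_of_nonneg hi.le, inv_mul_lt_iff₀ hμ, mul_one]
    exact h3
  have e2 : ‖((μ⁻¹ : ℝ) : ℂ) * ξ - 1‖ < 1 := by
    have : ((μ⁻¹ : ℝ) : ℂ) * ξ - 1 = ((μ⁻¹ : ℝ) : ℂ) * (ξ - μ) := by
      have : (μ : ℂ) ≠ 0 := by exact_mod_cast hμ.ne'
      push_cast; field_simp
    rw [this, norm_mul, Complex.norm_real, Real.norm_of_nonneg hi.le, inv_mul_lt_iff₀ hμ, mul_one]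
    exact h4
  have r1 := (Complex.re_le_norm _).trans_lt e1
  have r2 : 0 < (((μ⁻¹ : ℝ) : ℂ) * ξ).re := by
    have := (Complex.abs_re_le_norm (((μ⁻¹ : ℝ) : ℂ) * ξ - 1)).trans_lt e2
    rw [Complex.sub_re, Complex.one_re] at this
    linarith [(abs_lt.1 this).1]
  refine ⟨r2, r1, ?_, ?_, e1, e2⟩
  · rw [Complex.im_ofReal_mul]; positivity
  · rw [Complex.im_ofReal_mul, inv_mul_lt_iff₀ hμ]; exact h2

/-- The growing trapezoid sweeps the half-open trapezoid. -/
theorem mem_closure_place {γ μ : ℝ} {u z : ℂ} {σ : Bool} (hμ : 0 < μ)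
    (h : InTrap θ μ (frame u (Complex.exp (γ * Complex.I)) σ z)) :
    z ∈ closure (place u μ γ (conjIf σ '' trapezoid θ)) := by
  set e := Complex.exp (γ * Complex.I) with he
  have hen : ‖e‖ = 1 := Complex.norm_exp_ofReal_mul_I γ
  set ζ := frame u e σ z with hζ
  -- The open trapezoid lacks its bottom side; shifting up by a small `t > 0` enters it and tends to
  -- `z`.
  have hf : Continuous fun t : ℝ => u + e * conjIf σ (ζ + t * Complex.I) := by
    have := continuous_conjIf σ
    fun_prop
  have hz : u + e * conjIf σ (ζ + (0 : ℝ) * Complex.I) = z := by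
    refine frame_inj hen (u := u) (σ := σ) ?_
    have := frame_add_mul hen u σ 1 ζ
    simpa using this
  have htend : Tendsto (fun t : ℝ => u + e * conjIf σ (ζ + t * Complex.I)) (𝓝[>] 0) (𝓝 z) := by
    have := (hf.tendsto 0).mono_left (nhdsWithin_le_nhds (s := Set.Ioi 0))
    rwa [hz] at this
  refine mem_closure_of_tendsto htend ?_
  obtain ⟨h1, h2, h3, h4⟩ := h
  have c1 : ∀ᶠ t : ℝ in 𝓝[>] 0, (ζ + t * Complex.I).im < μ * Real.sin θ := by
    have hc : Continuous fun t : ℝ => (ζ + t * Complex.I).im := by fun_prop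
    exact ((hc.tendsto 0).eventually_lt_const (by simpa using h2)).filter_mono nhdsWithin_le_nhds
  have c2 : ∀ᶠ t : ℝ in 𝓝[>] 0, ‖ζ + t * Complex.I‖ < μ := by
    have hc : Continuous fun t : ℝ => ‖ζ + t * Complex.I‖ := by fun_prop
    exact ((hc.tendsto 0).eventually_lt_const (by simpa using h3)).filter_mono nhdsWithin_le_nhds
  have c3 : ∀ᶠ t : ℝ in 𝓝[>] 0, ‖ζ + t * Complex.I - μ‖ < μ := by
    have hc : Continuous fun t : ℝ => ‖ζ + t * Complex.I - μ‖ := by fun_prop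
    exact ((hc.tendsto 0).eventually_lt_const (by simpa using h4)).filter_mono nhdsWithin_le_nhds
  filter_upwards [c1, c2, c3, self_mem_nhdsWithin] with t t1 t2 t3 t4
  have t4' : 0 < t := t4
  have him : 0 < (ζ + t * Complex.I).im := by simp; linarith
  have hmem := mem_trapezoid_of_inTrap hμ ⟨him.le, t1, t2, t3⟩ him
  refine ⟨_, ⟨_, hmem, rfl⟩, ?_⟩
  have hμ' : (μ : ℂ) ≠ 0 := by exact_mod_cast hμ.ne'
  dsimp only
  rw [← he]
  congr 1
  cases σ
  · simp only [conjIf, cond_false]; push_cast; field_simp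
  · simp only [conjIf, cond_true, map_mul, Complex.conj_ofReal]; push_cast; field_simp

/-- `InTrap` is an open condition on the size, so a point of the copy of size `L` is already in a
closed copy of smaller size and must be `u`. But the origin of the frame is at distance exactly `L`
from `L`. -/
theorem not_inTrap_of_growth {P : Finset ℂ} {γ L : ℝ} {u : ℂ} {σ : Bool} (hL : 0 < L)
    (h : ∀ μ : ℝ, 0 < μ → μ < L → ∀ w ∈ P,
      w ∈ closure (place u μ γ (conjIf σ '' trapezoid θ)) → w = u) :
    ∀ z ∈ P, ¬ InTrap θ L (frame u (Complex.exp (γ * Complex.I)) σ z) := by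
  intro z hz hT
  obtain ⟨μ, h1, h2, h3⟩ := exists_lt_inTrap hL hT
  obtain rfl := h μ h1 h2 z hz (mem_closure_place h1 h3)
  rw [frame_self] at hT
  have := hT.2.2.2
  simp [abs_of_pos hL] at this

theorem conn_of_growthHits (S : Setting α θ A k N) {P : Finset ℂ} {G : SimpleGraph ℂ}
    (hstep : StepProp α P G) {u v : ℂ} (hu : u ∈ P) (hv : v ∈ P) {γ : ℝ}
    (hγ : IsDir α (Complex.exp (γ * Complex.I))) {σ : Bool} {φ : ℝ} (h0 : 0 ≤ φ) (h1 : φ ≤ θ)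
    (h1' : φ < θ ∨ σ = true) {L : ℝ} (hL : 0 < L)
    (hvL : v = u + L * (Complex.exp (γ * Complex.I) * conjIf σ (Complex.exp (φ * Complex.I))))
    (h : ∀ μ : ℝ, 0 < μ → μ < L → ∀ w ∈ P,
      w ∈ closure (place u μ γ (conjIf σ '' trapezoid θ)) → w = u) :
    Conn G u v (A * (1 + 3 * α) * dist u v) := by
  have hen := hγ.norm_eq_one
  have hF : frame u (Complex.exp (γ * Complex.I)) σ v = L * Complex.exp (φ * Complex.I) := by
    rw [hvL, frame_add_mul hen]
  have hd : dist u v = L := by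
    rw [← norm_frame hen u σ v, hF, norm_mul, Complex.norm_exp_ofReal_mul_I, Complex.norm_real,
      Real.norm_of_nonneg hL.le, mul_one]
  have hT := not_inTrap_of_growth hL h
  rw [← hd] at hF hT
  refine (edgeOK S hstep u hu v hv _ σ φ hγ h0 h1 h1' hF hT).mono ?_
  have hA := S.A_pos
  have h2 : min (Real.sin φ) (Real.sin α) ≤ α := (min_le_right _ _).trans S.sin_alpha_le
  have h3 : A * dist u v * min (Real.sin φ) (Real.sin α) ≤ A * dist u v * α := by gcongr
  linarith

theorem conn_of_tyEdge (hk : 0 < k) (S : Setting (Real.pi / k) (tyAngle (2 * k)) A k N)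
    {P : Finset ℂ} {G : SimpleGraph ℂ} (hstep : StepProp (Real.pi / k) P G) {u v : ℂ}
    (h : TYEdge (2 * k) P u v) : Conn G u v (A * (1 + 3 * (Real.pi / k)) * dist u v) := by
  obtain ⟨hu, hv, j, -, h⟩ := h
  have hdir : IsDir (Real.pi / k)
      (Complex.exp ((2 * j * Real.pi / ((2 * k : ℕ) : ℝ) : ℝ) * Complex.I)) := by
    refine ⟨j, ?_⟩
    have hk' : (k : ℝ) ≠ 0 := by positivity
    congr 3
    push_cast; field_simp
  rcases h with ⟨L, hL, ⟨_, ⟨φ, hφ, rfl⟩, hvL⟩, hg⟩ | ⟨L, hL, ⟨_, ⟨φ, hφ, rfl⟩, hvL⟩, hg⟩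
  · refine conn_of_growthHits S hstep hu hv hdir (σ := false) (φ := φ) hφ.1 hφ.2.le (Or.inl hφ.2) hL
      hvL.symm ?_
    have : conjIf false '' trapezoid (tyAngle (2 * k)) = trapezoid (tyAngle (2 * k)) :=
      Set.image_id _
    rwa [this]
  · refine conn_of_growthHits S hstep hu hv hdir (σ := true) (φ := -φ) (by linarith [hφ.2])
      (by linarith [hφ.1]) (Or.inr rfl) hL ?_ hg
    rw [← hvL]
    simp [conjIf, ← Complex.exp_conj]

/-- The constants for `k ≥ 42`. -/
theorem setting_of_le (hk : 42 ≤ k) :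
    Setting (Real.pi / k) (tyAngle (2 * k)) (1 + 1200 * (Real.pi / k)) k ⌈((2 * k : ℕ) : ℝ) / 8⌉₊ := by
  have hk' : (42 : ℝ) ≤ k := by exact_mod_cast hk
  have hk0 : (0 : ℝ) < k := by linarith
  have hpi := Real.pi_pos
  have hpi' := Real.pi_lt_d4
  -- This is where `k ≥ 42` is used: `42 · 0.0748 = 3.1416`.
  have hle : Real.pi / k ≤ 0.0748 := by
    rw [div_le_iff₀ hk0]; linarith
  have hpos : 0 < Real.pi / k := by positivity
  have hN : tyAngle (2 * k) = ⌈((2 * k : ℕ) : ℝ) / 8⌉₊ * (Real.pi / k) := by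
    unfold tyAngle
    push_cast; field_simp
  have hN1 : (k : ℝ) ≤ 4 * ⌈((2 * k : ℕ) : ℝ) / 8⌉₊ := by
    have := Nat.le_ceil (((2 * k : ℕ) : ℝ) / 8)
    push_cast at this ⊢; linarith
  have hN2 : 4 * (⌈((2 * k : ℕ) : ℝ) / 8⌉₊ : ℝ) ≤ k + 3 := by
    have h1 := Nat.ceil_lt_add_one (show (0 : ℝ) ≤ ((2 * k : ℕ) : ℝ) / 8 by positivity)
    have h2 : (4 * ⌈((2 * k : ℕ) : ℝ) / 8⌉₊ : ℝ) < (k + 4 : ℕ) := by push_cast at h1 ⊢; linarith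
    have h3 : 4 * ⌈((2 * k : ℕ) : ℝ) / 8⌉₊ < k + 4 := by exact_mod_cast h2
    exact_mod_cast (show 4 * ⌈((2 * k : ℕ) : ℝ) / 8⌉₊ ≤ k + 3 by omega)
  have hkk : k * (Real.pi / k) = Real.pi := by field_simp
  refine ⟨hpos, hle, hkk, hN, ?_, ?_, ?_⟩
  · rw [hN]
    have := mul_le_mul_of_nonneg_right hN1 hpos.le
    linarith
  · rw [hN]
    have := mul_le_mul_of_nonneg_right hN2 hpos.le
    linarith
  -- With `A = 1 + 1200 α` this amounts to `15840 α ≤ 1186.8`, which barely holds at `α = 0.0748`.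
  · nlinarith

end YaoYao

theorem mainTheorem2 :
    ∃ τ' : ℕ → ℝ,
      (fun k : ℕ => τ' k - Real.sqrt 2) =O[Filter.atTop] (fun k : ℕ => (k : ℝ)⁻¹) ∧
      ∀ k : ℕ, 42 ≤ k → ∀ (P : Finset ℂ) (Y E : ℂ → ℂ → Prop),
        YaoYao.IsYaoGraph (2 * k) P Y → YaoYao.IsYaoYaoGraph (2 * k) P Y E →
          (∀ u v : ℂ, YaoYao.TYEdge (2 * k) P u v →
            YaoYao.graphDist (SimpleGraph.fromRel E) u v ≤ ENNReal.ofReal (τ' k * dist u v)) ∧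
          (∀ u ∈ P, ∀ v ∈ P,
            YaoYao.graphDist (SimpleGraph.fromRel E) u v ≤
              ENNReal.ofReal (τ' k) *
                YaoYao.graphDist (SimpleGraph.fromRel (YaoYao.TYEdge (2 * k) P)) u v) := by
  refine ⟨fun k => Real.sqrt 2 + 5000 * (k : ℝ)⁻¹, ?_, ?_⟩
  · simp only [add_sub_cancel_left]
    exact Asymptotics.isBigO_const_mul_self _ _ _
  intro k hk P Y E hY hE
  have hk0 : 0 < k := by omega
  have hS := YaoYao.setting_of_le hk
  have hstep := YaoYao.stepProp_of_isYaoYaoGraph hk0 hY hE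
  -- After replacing `√2` by `1`, it suffices that `(1203 + 3600 α) π ≤ 5000`.
  have hτ : (1 + 1200 * (Real.pi / k)) * (1 + 3 * (Real.pi / k))
      ≤ Real.sqrt 2 + 5000 * (k : ℝ)⁻¹ := by
    have h1 : (1 : ℝ) ≤ Real.sqrt 2 := Real.one_le_sqrt.2 (by norm_num)
    have h2 := hS.pos
    have h3 := hS.le
    have h4 : Real.pi / k ≤ 3.1416 * (k : ℝ)⁻¹ := by
      rw [div_eq_mul_inv]
      gcongr
      exact Real.pi_lt_d4.le
    nlinarith
  have key : ∀ u v : ℂ, YaoYao.TYEdge (2 * k) P u v →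
      YaoYao.Conn (SimpleGraph.fromRel E) u v ((Real.sqrt 2 + 5000 * (k : ℝ)⁻¹) * dist u v) :=
    fun u v h => (YaoYao.conn_of_tyEdge hk0 hS hstep h).mono (by gcongr)
  refine ⟨fun u v h => (key u v h).graphDist_le, fun u _ v _ => ?_⟩
  refine YaoYao.graphDist_le_mul (by positivity) (fun p q hpq => ?_) u v
  rw [SimpleGraph.fromRel_adj] at hpq
  rcases hpq.2 with h | h
  · exact key p q h
  · rw [dist_comm]
    exact (key q p h).symm

end
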